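/- Setting. Functions on the torus $\mathbb T=[-1,1)^2$ are identified with functions on $\mathbb R^2$ of period $2$ in both variables. Let $\omega(x,t)$, $t\ge 0$, be a classical solution of the two-dimensional Euler equation in vorticity form $$\omega_t+u\cdot\nabla\omega=0,\qquad u=\nabla^\perp\psi=(-\partial_{x_2}\psi,\partial_{x_1}\psi),\qquad -\Delta\psi(\cdot,t)=\omega(\cdot,t),$$ on $\mathbb T$, with $\psi(\cdot,t)\in C^2(\mathbb T)$; that is, $\omega(\cdot,t)\in C^2(\mathbb T)$ for every $t\ge0$, and $\omega_t$ exists (one-sided at $t=0$) and is continuous on $\mathbb R^2\times[0,\infty)$ (for instance $\omega\in C^1([0,\infty),C^2(\mathbb T))$). Assume that $\omega$ is double-odd for all times: $\omega(-x_1,x_2,t)=-\omega(x_1,x_2,t)=\omega(x_1,-x_2,t)$. Write $\omega_0=\omega(\cdot,0)$, $\tilde x=(-x_1,x_2)$, $\bar x=(x_1,-x_2)$, $c_0=2/\pi$, let $|\cdot|$ be the Euclidean norm, and put $$Q_1(x,t)=c_0\int_{[0,1]^2}\Big[\tfrac{y_1(y_2-x_2)}{|y-x|^2|y-\tilde x|^2}+\tfrac{y_1(y_2+x_2)}{|y+x|^2|y-\bar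 x|^2}\Big]\omega(y,t)\,dy+Q_1^r(x,t),$$ $$Q_2(x,t)=c_0\int_{[0,1]^2}\Big[\tfrac{y_2(y_1+x_1)}{|y+x|^2|y-\tilde x|^2}+\tfrac{y_2(y_1-x_1)}{|y-x|^2|y-\bar x|^2}\Big]\omega(y,t)\,dy+Q_2^r(x,t),$$ where $Q_i^r$ is given by $c_0$ times the integral of the same integrand over $[0,\infty)^2\setminus[0,1]^2$, understood as the limit as $R\to\infty$ of the integrals over $[0,R]^2\setminus[0,1]^2$. (With this normalization $u_1=-x_1Q_1$ and $u_2=x_2Q_2$.) For $0<\alpha<\frac14$ and $x_1,x_2\ge0$ let $$M(x,t)=\max_{0\le y_1,y_2\le\max\{x_1,x_2\}}\Big\{\big|y_1^\alpha\,\partial_{x_1}\omega(y,t)\big|,\ \big|y_2^\alpha\,\partial_{x_2}\omega(y,t)\big|\Big\}.$$ Theorem. There are universal constants $m_0\in(0,1)$ and $K>0$ with the following property. Let $0<\alpha<\frac14$ and let $\omega$ be as above with $\omega_0\ge0$ on $[0,1]^2$. Suppose that the measure $$m=\big|\{x\in[0,1]^2:\ \omega_0(x)=\|\omega_0\|_\infty\}\big|$$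 satisfies $m_0<m<1$. Then there are $\beta_0>0$ and $A>0$ such that for all $t\ge0$ and all $x=(x_1,x_2)$ with $x_1,x_2\ge0$ and $|x|\le K(1-m)$ the integrals and limits defining $Q_1(x,t),Q_2(x,t)$ exist and $$Q_2(x,t)+A\,M(x,t)\,|x|^{1-\alpha}\ge\beta_0,\qquad Q_1(x,t)+A\,M(x,t)\,|x|^{1-\alpha}\ge\beta_0.$$ In particular the flow is hyperbolic near the origin: there are $\rho,A,\beta_0>0$ such that $Q_i(x,t)+A|x|^{1-\alpha}M(x,t)\ge\beta_0$ for $i=1,2$, all $t\ge0$ and all $0\le x_1,x_2\le\rho$. -/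

import Mathlib

open Set Filter Topology MeasureTheory

noncomputable section

namespace EulerTorus

/-- Points of the plane; the periodic cell is `[-1,1)²`. All Euclidean lengths are written out. -/
abbrev Plane : Type := ℝ × ℝ

/-- The squared Euclidean length. -/
def lenSq (x : Plane) : ℝ := x.1 ^ 2 + x.2 ^ 2

/-- The Euclidean length `|x|`. -/
def len (x : Plane) : ℝ := √(lenSq x)

/-- The closed square `[0, r]²`. -/
def box (r : ℝ) : Set Plane := Icc (0, 0) (r, r)

/-- Partial derivative in the first variable. -/
def d1 (f : Plane → ℝ) (x : Plane) : ℝ := fderiv ℝ f x (1, 0)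

/-- Partial derivative in the second variable. -/
def d2 (f : Plane → ℝ) (x : Plane) : ℝ := fderiv ℝ f x (0, 1)

/-- Functions on the torus `[-1,1)²`: functions on the plane with period `2` in both variables. -/
def IsPeriodic (f : Plane → ℝ) : Prop :=
  ∀ x : Plane, f (x.1 + 2, x.2) = f x ∧ f (x.1, x.2 + 2) = f x

/-- Odd in each of the two variables. -/
def IsDoubleOdd (f : Plane → ℝ) : Prop :=
  ∀ x : Plane, f (-x.1, x.2) = -f x ∧ f (x.1, -x.2) = -f x

/-- `ψ = (-Δ)⁻¹ f` on the torus (determined up to an additive constant). -/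
structure IsStreamFunction (ψ f : Plane → ℝ) : Prop where
  contDiff : ContDiff ℝ 2 ψ
  periodic : IsPeriodic ψ
  laplace : ∀ x, -(d1 (d1 ψ) x + d2 (d2 ψ) x) = f x

/-- `ω` is a classical solution, for all times `t ≥ 0`, of the Euler equation in vorticity form
`ω_t + u · ∇ω = 0` on the torus, with velocity `u = ∇^⊥ (-Δ)⁻¹ ω = (-∂₂ψ, ∂₁ψ)`:
each `ω t` is a `C²` function on the torus, and `ω_t` (one-sided at `t = 0`) exists and is
continuous on `[0,∞) × ℝ²`. -/
structure IsEulerSolution (ω : ℝ → Plane → ℝ) : Prop where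
  contDiff : ∀ t, 0 ≤ t → ContDiff ℝ 2 (ω t)
  periodic : ∀ t, 0 ≤ t → IsPeriodic (ω t)
  euler : ∃ ωt ψ : ℝ → Plane → ℝ,
    ContinuousOn (fun p : ℝ × Plane => ωt p.1 p.2) (Ici 0 ×ˢ univ) ∧
    ∀ t, 0 ≤ t → IsStreamFunction (ψ t) (ω t) ∧
      ∀ x, HasDerivWithinAt (fun s => ω s x) (ωt t x) (Ici 0) t ∧
        ωt t x + ((-d2 (ψ t) x) * d1 (ω t) x + d1 (ψ t) x * d2 (ω t) x) = 0

/-- `x̃ = (-x₁, x₂)`. -/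
def til (x : Plane) : Plane := (-x.1, x.2)

/-- `x̄ = (x₁, -x₂)`. -/
def bar (x : Plane) : Plane := (x.1, -x.2)

def G11 (x y : Plane) : ℝ := y.1 * (y.2 - x.2) / (lenSq (y - x) * lenSq (y - til x))

def G12 (x y : Plane) : ℝ := y.1 * (y.2 + x.2) / (lenSq (y + x) * lenSq (y - bar x))

def G21 (x y : Plane) : ℝ := y.2 * (y.1 + x.1) / (lenSq (y + x) * lenSq (y - til x))

def G22 (x y : Plane) : ℝ := y.2 * (y.1 - x.1) / (lenSq (y - x) * lenSq (y - bar x))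

/-- The kernel of `Q₁`. -/
def K1 (x y : Plane) : ℝ := G11 x y + G12 x y

/-- The kernel of `Q₂`. -/
def K2 (x y : Plane) : ℝ := G21 x y + G22 x y

/-- The constant for which `u₁ = -x₁ Q₁` and `u₂ = x₂ Q₂`: folding the Biot-Savart integral
`(1/2π) ∫ (y-x)^⊥ / |y-x|² ω(y) dy` over the four quadrants produces `4 / (2π)`. -/
def c0 : ℝ := 2 / Real.pi

/-- The far part `c₀ ∫_{[0,∞)² ∖ [0,1]²} K(x,y) f(y) dy`, truncated to `[0,R]²`. -/
def farPart (K : Plane → Plane → ℝ) (f : Plane → ℝ) (x : Plane) (R : ℝ) : ℝ :=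
  c0 * ∫ y in box R \ box 1, K x y * f y

/-- The integral operator `c₀ ∫_{[0,1]²} K(x,y) f(y) dy + Q^r(x)`, the remainder `Q^r` being the
limit of the far part over growing squares. -/
def Qop (K : Plane → Plane → ℝ) (f : Plane → ℝ) (x : Plane) : ℝ :=
  c0 * (∫ y in box 1, K x y * f y) + limUnder atTop (farPart K f x)

/-- The integrals and the limit in `Qop K f x` all exist. -/
def QopExists (K : Plane → Plane → ℝ) (f : Plane → ℝ) (x : Plane) : Prop :=
  (∀ R, IntegrableOn (fun y => K x y * f y) (box R)) ∧
    ∃ l, Tendsto (farPart K f x) atTop (𝓝 l)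

/-- `Q₁`, for a vorticity `f` at a fixed time. -/
def Q1 (f : Plane → ℝ) (x : Plane) : ℝ := Qop K1 f x

/-- `Q₂`, for a vorticity `f` at a fixed time. -/
def Q2 (f : Plane → ℝ) (x : Plane) : ℝ := Qop K2 f x

/-- `M(x)`, for a vorticity `f` at a fixed time: the maximum of `|y₁^α ∂₁f(y)|` and
`|y₂^α ∂₂f(y)|` over `0 ≤ y₁, y₂ ≤ max x₁ x₂`. -/
def M (α : ℝ) (f : Plane → ℝ) (x : Plane) : ℝ :=
  sSup ((fun y : Plane => max |y.1 ^ α * d1 f y| |y.2 ^ α * d2 f y|) '' box (max x.1 x.2))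

/-- The maximum norm. -/
def supNorm (f : Plane → ℝ) : ℝ := ⨆ x, |f x|

/-- The measure of the set of points of `[0,1]²` where `f` equals its maximum norm. -/
def topMeasure (f : Plane → ℝ) : ℝ :=
  volume.real {x : Plane | x ∈ box 1 ∧ f x = supNorm f}

/-- The flow is hyperbolic near the origin. -/
def HyperbolicNearOrigin (α : ℝ) (ω : ℝ → Plane → ℝ) : Prop :=
  ∃ ρ A β₀ : ℝ, 0 < ρ ∧ 0 < A ∧ 0 < β₀ ∧ ∀ t, 0 ≤ t → ∀ x : Plane,
    0 ≤ x.1 → x.1 ≤ ρ → 0 ≤ x.2 → x.2 ≤ ρ →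
      β₀ ≤ Q1 (ω t) x + A * len x ^ (1 - α) * M α (ω t) x ∧
      β₀ ≤ Q2 (ω t) x + A * len x ^ (1 - α) * M α (ω t) x

end EulerTorus

end

open EulerTorus

noncomputable section

namespace EulerTorus

/-! ### Calculus and symmetry preliminaries -/

/-! At every time the vorticity is a rearrangement of its initial datum on the unit square, so it
still equals its maximum `N` outside a set of measure at most `1 - m`. This produces a large
positive term in `Q₁` that beats every other contribution.

Rearrangement (`map_vorticity_eq`): oddness and periodicity make the vorticity vanish on all four
sides of the square, so for `Φ(0) = 0` the field `Φ(ω) u` has no flux through them and `∫ Φ(ω)` is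
constant in time. Taking sines and cosines for `Φ` gives the characteristic function of the
distribution; no particle trajectories are needed.

Fixed-time bound (`Q1_lower`). The kernel `G12` is nonnegative and of size `s⁻²` on the dyadic
square of side comparable to `s`, as long as `s` dominates `|x|`. If the defect set is small
compared with `4⁻ⁿ`, each of the first `n` dyadic squares contributes a fixed multiple of `N`: the
discrete form of a logarithmic divergence (`main_lower`). The kernel `G11` is negative only for `y₂
< x₂`. There the Hölder decay of `ω` at the axis, measured by `M`, handles `y₁ ≤ max x₁ x₂`, and the
bound `N` handles larger `y₁`; the cost is `O(N) + O(M |x|^(1-α))` (`near_lower`). The far part is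
only conditionally convergent, since the kernel decays like `|y|⁻²`; the zero mean of `ω` in `y₁`
gains one power after an integration by parts, giving `O(N)` (`far_G11`). All these constants are
universal, so a universal `n` leaves a surplus `c0 * N`.

Finally `Q₂` is `Q₁` with the two coordinates exchanged (`Q2_eq`), and all hypotheses are symmetric
under this exchange. -/

lemma contDiff_d1 {f : Plane → ℝ} {n m : WithTop ℕ∞} (hf : ContDiff ℝ n f) (h : m + 1 ≤ n) :
    ContDiff ℝ m (d1 f) := (hf.fderiv_right h).clm_apply contDiff_const

lemma contDiff_d2 {f : Plane → ℝ} {n m : WithTop ℕ∞} (hf : ContDiff ℝ n f) (h : m + 1 ≤ n) :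
    ContDiff ℝ m (d2 f) := (hf.fderiv_right h).clm_apply contDiff_const

lemma d1_d2_comm {f : Plane → ℝ} (hf : ContDiff ℝ 2 f) (x : Plane) :
    d1 (d2 f) x = d2 (d1 f) x := by
  have hd : DifferentiableAt ℝ (fderiv ℝ f) x :=
    ((hf.fderiv_right (m := 1) (by norm_num)).differentiable (by norm_num)) x
  have key : ∀ v w : Plane, fderiv ℝ (fun y => fderiv ℝ f y v) x w
      = fderiv ℝ (fderiv ℝ f) x w v := by
    intro v w
    have := (hd.hasFDerivAt.clm_apply (hasFDerivAt_const v x)).fderiv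
    rw [this]; simp
  have hs : IsSymmSndFDerivAt ℝ f x := hf.contDiffAt.isSymmSndFDerivAt (by simp)
  unfold d1 d2
  rw [key, key]
  exact hs _ _

lemma isCompact_box (r : ℝ) : IsCompact (box r) := isCompact_Icc

lemma measurableSet_box (r : ℝ) : MeasurableSet (box r) := measurableSet_Icc

lemma mem_box {r : ℝ} {x : Plane} : x ∈ box r ↔ (0 ≤ x.1 ∧ x.1 ≤ r) ∧ 0 ≤ x.2 ∧ x.2 ≤ r := by
  constructor
  · rintro ⟨h1, h2⟩; exact ⟨⟨h1.1, h2.1⟩, h1.2, h2.2⟩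
  · rintro ⟨⟨h1, h2⟩, h3, h4⟩; exact ⟨⟨h1, h3⟩, h2, h4⟩

lemma box_eq_prod (r : ℝ) : box r = Icc 0 r ×ˢ Icc 0 r := by
  ext x; rw [mem_box, mem_prod, mem_Icc, mem_Icc]

lemma volume_box_one : volume (box 1) = 1 := by
  rw [box_eq_prod, Measure.volume_eq_prod, Measure.prod_prod]; simp

lemma IsDoubleOdd.zero_left {f : Plane → ℝ} (h : IsDoubleOdd f) (y : ℝ) : f (0, y) = 0 := by
  have := (h (0, y)).1; simp at this; linarith

lemma IsDoubleOdd.zero_right {f : Plane → ℝ} (h : IsDoubleOdd f) (y : ℝ) : f (y, 0) = 0 := by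
  have := (h (y, 0)).2; simp at this; linarith

lemma one_left {f : Plane → ℝ} (h : IsDoubleOdd f) (hp : IsPeriodic f) (y : ℝ) :
    f (1, y) = 0 := by
  have h1 := (h (1, y)).1
  have h2 := (hp (-1, y)).1
  norm_num at h1 h2; linarith

lemma one_right {f : Plane → ℝ} (h : IsDoubleOdd f) (hp : IsPeriodic f) (y : ℝ) :
    f (y, 1) = 0 := by
  have h1 := (h (y, 1)).2
  have h2 := (hp (y, -1)).2
  norm_num at h1 h2; linarith

/-! ### Conservation of the distribution function -/

/-- A `C¹` function vanishing on the boundary of the unit square is not transported, on average,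
by a divergence-free field. -/
lemma integral_transport_eq_zero {ψ g : Plane → ℝ} (hψ : ContDiff ℝ 2 ψ) (hg : ContDiff ℝ 1 g)
    (g0 : ∀ y, g (0, y) = 0) (g1 : ∀ y, g (1, y) = 0) (g2 : ∀ y, g (y, 0) = 0)
    (g3 : ∀ y, g (y, 1) = 0) :
    ∫ y in box 1, ((-d2 ψ y) * d1 g y + d1 ψ y * d2 g y) = 0 := by
  have e1 := contDiff_d1 (m := 1) hψ (by norm_num)
  have e2 := contDiff_d2 (m := 1) hψ (by norm_num)
  have c1 : ContDiff ℝ 1 (fun y => -d2 ψ y * g y) := e2.neg.mul hg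
  have c2 : ContDiff ℝ 1 (fun y => d1 ψ y * g y) := e1.mul hg
  have one : (1 : WithTop ℕ∞) ≠ 0 := one_ne_zero
  have k1 : Continuous (d1 (fun y => -d2 ψ y * g y)) :=
    (contDiff_d1 (m := 0) c1 (by norm_num)).continuous
  have k2 : Continuous (d2 (fun y => d1 ψ y * g y)) :=
    (contDiff_d2 (m := 0) c2 (by norm_num)).continuous
  -- The field is `g ∇^⊥ψ`: its divergence is the transport term because the mixed derivatives of
  -- `ψ` cancel, and its flux vanishes with `g` on each side.
  have div := integral_divergence_prod_Icc_of_hasFDerivAt_of_le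
    (fun y => -d2 ψ y * g y) (fun y => d1 ψ y * g y)
    (fderiv ℝ (fun y => -d2 ψ y * g y)) (fderiv ℝ (fun y => d1 ψ y * g y))
    (0, 0) (1, 1) ⟨zero_le_one, zero_le_one⟩ c1.continuous.continuousOn c2.continuous.continuousOn
    (fun x _ => (c1.differentiable one x).hasFDerivAt)
    (fun x _ => (c2.differentiable one x).hasFDerivAt)
    ((k1.add k2).continuousOn.integrableOn_compact isCompact_Icc)
  simp only [g0, g1, g2, g3, mul_zero, intervalIntegral.integral_zero, sub_zero, add_zero] at div
  rw [← div]
  refine setIntegral_congr_fun (measurableSet_box 1) fun y _ => ?_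
  have dg := hg.differentiable one y
  have d2' := e2.differentiable one y
  have d1' := e1.differentiable one y
  have a1 : fderiv ℝ (fun y => -d2 ψ y * g y) y (1, 0)
      = -d2 ψ y * d1 g y - d1 (d2 ψ) y * g y := by
    have h : HasFDerivAt (fun y => -d2 ψ y * g y) _ y := d2'.hasFDerivAt.neg.mul dg.hasFDerivAt
    rw [h.fderiv]
    simp [d1]; ring
  have a2 : fderiv ℝ (fun y => d1 ψ y * g y) y (0, 1)
      = d1 ψ y * d2 g y + d2 (d1 ψ) y * g y := by
    have h : HasFDerivAt (fun y => d1 ψ y * g y) _ y := d1'.hasFDerivAt.mul dg.hasFDerivAt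
    rw [h.fderiv]
    simp [d2]; ring
  simp only [a1, a2, d1_d2_comm hψ]
  ring

/-- Integrals of bounded `C¹` functions of the vorticity are conserved. -/
lemma integral_comp_conserved {ω : ℝ → Plane → ℝ} (hω : IsEulerSolution ω)
    (hodd : ∀ t, 0 ≤ t → IsDoubleOdd (ω t)) {Φ Φ' : ℝ → ℝ} (hΦ : ContDiff ℝ 1 Φ)
    (hΦ' : ∀ s, HasDerivAt Φ (Φ' s) s) (hc : Continuous Φ') (h0 : Φ 0 = 0) {B : ℝ}
    (hB : ∀ s, |Φ s| ≤ B) (hB' : ∀ s, |Φ' s| ≤ B) {T : ℝ} (hT : 0 ≤ T) :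
    ∫ y in box 1, Φ (ω T y) = ∫ y in box 1, Φ (ω 0 y) := by
  obtain ⟨ωt, ψ, hcont, hE⟩ := hω.euler
  rcases hT.eq_or_lt with rfl | hT
  · rfl
  have hcω : ∀ t, 0 ≤ t → Continuous (ω t) := fun t ht => (hω.contDiff t ht).continuous
  have hfin : IsFiniteMeasure (volume.restrict (box 1)) :=
    ⟨by rw [Measure.restrict_apply_univ, volume_box_one]; simp⟩
  have hB0 : 0 ≤ B := (abs_nonneg _).trans (hB 0)
  have hzero : ∀ t, 0 ≤ t → ∫ y in box 1, Φ' (ω t y) * ωt t y = 0 := by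
    intro t ht
    have hg : ContDiff ℝ 1 (fun y => Φ (ω t y)) :=
      hΦ.comp ((hω.contDiff t ht).of_le (by norm_num))
    have := integral_transport_eq_zero (hE t ht).1.contDiff hg
      (fun y => by simp [(hodd t ht).zero_left, h0])
      (fun y => by simp [one_left (hodd t ht) (hω.periodic t ht), h0])
      (fun y => by simp [(hodd t ht).zero_right, h0])
      (fun y => by simp [one_right (hodd t ht) (hω.periodic t ht), h0])
    rw [← neg_eq_zero, ← this, ← integral_neg]
    refine setIntegral_congr_fun (measurableSet_box 1) fun y _ => ?_
    have hd : HasFDerivAt (fun y => Φ (ω t y)) (Φ' (ω t y) • fderiv ℝ (ω t) y) y :=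
      (hΦ' (ω t y)).comp_hasFDerivAt y
        (((hω.contDiff t ht).differentiable (by norm_num) y).hasFDerivAt)
    have q1 : d1 (fun y => Φ (ω t y)) y = Φ' (ω t y) * d1 (ω t) y := by
      unfold d1; rw [hd.fderiv]; simp
    have q2 : d2 (fun y => Φ (ω t y)) y = Φ' (ω t y) * d2 (ω t) y := by
      unfold d2; rw [hd.fderiv]; simp
    have := ((hE t ht).2 y).2
    simp only [q1, q2]
    linear_combination (-Φ' (ω t y)) * this
  -- At time `0` only a one-sided derivative is available, so the mean value theorem is used with
  -- continuity on `[0, T]` and zero derivative in the interior.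
  have hcF : ContinuousOn (fun t => ∫ y in box 1, Φ (ω t y)) (Icc 0 T) := by
    intro t ht
    refine continuousWithinAt_of_dominated (bound := fun _ => B) ?_ ?_ (integrable_const _) ?_
    · filter_upwards [self_mem_nhdsWithin] with s hs
      exact (hΦ.continuous.comp (hcω s hs.1)).aestronglyMeasurable
    · exact Eventually.of_forall fun s => Eventually.of_forall fun y => hB _
    · refine Eventually.of_forall fun y => ?_
      have := (((hE t ht.1).2 y).1.continuousWithinAt).mono (Icc_subset_Ici_self : Icc 0 T ⊆ Ici 0)
      exact hΦ.continuous.continuousAt.comp_continuousWithinAt this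
  have hder : ∀ t ∈ Ioo 0 T, HasDerivAt (fun t => ∫ y in box 1, Φ (ω t y))
      ((fun _ => (0 : ℝ)) t) t := by
    intro t ht
    -- On `[t/2, 2t]`, away from time `0`, derivatives are two-sided, and compactness bounds `ωt`,
    -- which dominates the differentiated integrand.
    have hsub : Icc (t / 2) (2 * t) ×ˢ box 1 ⊆ Ici (0 : ℝ) ×ˢ (univ : Set Plane) :=
      prod_mono (fun s hs => le_trans (by linarith [ht.1] : (0 : ℝ) ≤ t / 2) hs.1)
        (subset_univ _)
    obtain ⟨C, hC⟩ := (isCompact_Icc.prod (isCompact_box 1)).exists_bound_of_continuousOn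
      (hcont.mono hsub)
    have hnn : ∀ s ∈ Ioo (t / 2) (2 * t), 0 < s := fun s hs => by linarith [hs.1, ht.1]
    have := hasDerivAt_integral_of_dominated_loc_of_deriv_le (μ := volume.restrict (box 1))
      (F := fun t y => Φ (ω t y)) (F' := fun t y => Φ' (ω t y) * ωt t y) (x₀ := t)
      (s := Ioo (t / 2) (2 * t)) (bound := fun _ => B * C)
      (Ioo_mem_nhds (by linarith [ht.1]) (by linarith [ht.1])) ?_ ?_ ?_ ?_ (integrable_const _) ?_
    · have h2 := this.2
      rwa [hzero t ht.1.le] at h2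
    · filter_upwards [Ioi_mem_nhds ht.1] with s hs
      exact (hΦ.continuous.comp (hcω s (le_of_lt hs))).aestronglyMeasurable
    · exact (hΦ.continuous.comp (hcω t ht.1.le)).continuousOn.integrableOn_compact
        (isCompact_box 1)
    · have h1 : Continuous (ωt t) := by
        have : Continuous (fun y : Plane => (t, y)) := by fun_prop
        have := hcont.comp_continuous this (fun y => ⟨ht.1.le, mem_univ _⟩)
        exact this
      exact ((hc.comp (hcω t ht.1.le)).mul h1).aestronglyMeasurable
    · refine (ae_restrict_iff' (measurableSet_box 1)).2 (Eventually.of_forall fun y hy s hs => ?_)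
      rw [norm_mul]
      exact mul_le_mul (hB' _) (hC (s, y) ⟨⟨hs.1.le, hs.2.le⟩, hy⟩) (norm_nonneg _) hB0
    · refine Eventually.of_forall fun y s hs => ?_
      have hs0 := hnn s hs
      exact (hΦ' _).comp s
        (((hE s hs0.le).2 y).1.hasDerivAt (Ici_mem_nhds hs0))
  obtain ⟨c, -, hc⟩ := exists_hasDerivAt_eq_slope _ _ hT hcF hder
  have := (div_eq_zero_iff.1 hc.symm).resolve_right (by linarith)
  linarith

/-- The distribution of the vorticity on the unit square does not change. -/
lemma map_vorticity_eq {ω : ℝ → Plane → ℝ} (hω : IsEulerSolution ω)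
    (hodd : ∀ t, 0 ≤ t → IsDoubleOdd (ω t)) {T : ℝ} (hT : 0 ≤ T) :
    (volume.restrict (box 1)).map (ω T) = (volume.restrict (box 1)).map (ω 0) := by
  have hfin : IsFiniteMeasure (volume.restrict (box 1)) :=
    ⟨by rw [Measure.restrict_apply_univ, volume_box_one]; simp⟩
  have hcω : ∀ t, 0 ≤ t → Continuous (ω t) := fun t ht => (hω.contDiff t ht).continuous
  have hint : ∀ t, 0 ≤ t → ∀ Φ : ℝ → ℝ, Continuous Φ →
      IntegrableOn (fun y => Φ (ω t y)) (box 1) := fun t ht Φ hΦ =>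
    (hΦ.comp (hcω t ht)).continuousOn.integrableOn_compact (isCompact_box 1)
  refine Measure.ext_of_charFun (funext fun ξ => ?_)
  have hb : ∀ c : ℝ, |c| ≤ 1 → |c * ξ| ≤ 2 + |ξ| := fun c hc => by
    rw [abs_mul]; nlinarith [abs_nonneg ξ, abs_nonneg c]
  have hsin := integral_comp_conserved hω hodd (Φ := fun s => Real.sin (ξ * s))
    (Φ' := fun s => Real.cos (ξ * s) * ξ) (B := 2 + |ξ|) (by fun_prop)
    (fun s => by simpa using ((hasDerivAt_id s).const_mul ξ).sin) (by fun_prop) (by simp)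
    (fun s => (Real.abs_sin_le_one _).trans (by linarith [abs_nonneg ξ]))
    (fun s => hb _ (Real.abs_cos_le_one _)) hT
  -- Subtracting `1` makes `Φ` vanish at `0`; on a set of finite measure this loses nothing.
  have hcos := integral_comp_conserved hω hodd (Φ := fun s => Real.cos (ξ * s) - 1)
    (Φ' := fun s => -Real.sin (ξ * s) * ξ) (B := 2 + |ξ|) (by fun_prop)
    (fun s => by simpa using ((hasDerivAt_id s).const_mul ξ).cos.sub_const 1) (by fun_prop)
    (by simp)
    (fun s => (abs_sub _ _).trans (by
      rw [abs_one]; linarith [abs_nonneg ξ, Real.abs_cos_le_one (ξ * s)]))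
    (fun s => hb _ (by rw [abs_neg]; exact Real.abs_sin_le_one _)) hT
  have hcos' : ∫ y in box 1, Real.cos (ξ * ω T y) = ∫ y in box 1, Real.cos (ξ * ω 0 y) := by
    rw [integral_sub (hint T hT (fun s => Real.cos (ξ * s)) (by fun_prop)) (integrable_const _),
      integral_sub (hint 0 le_rfl (fun s => Real.cos (ξ * s)) (by fun_prop))
        (integrable_const _)] at hcos
    linarith
  have key : ∀ t, 0 ≤ t → charFun ((volume.restrict (box 1)).map (ω t)) ξ
      = ((∫ y in box 1, Real.cos (ξ * ω t y) : ℝ) : ℂ)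
        + ((∫ y in box 1, Real.sin (ξ * ω t y) : ℝ) : ℂ) * Complex.I := by
    intro t ht
    rw [charFun_apply_real, integral_map (hcω t ht).aemeasurable (by fun_prop),
      ← integral_complex_ofReal, ← integral_complex_ofReal, ← integral_mul_const, ← integral_add]
    · refine integral_congr_ae (Eventually.of_forall fun y => ?_)
      simp only [Complex.exp_mul_I]
      push_cast
      rfl
    · exact (hint t ht (fun s => Real.cos (ξ * s)) (by fun_prop)).ofReal
    · exact ((hint t ht (fun s => Real.sin (ξ * s)) (by fun_prop)).ofReal).mul_const _
  rw [key T hT, key 0 le_rfl, hcos', hsin]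

/-! ### The Cauchy kernel -/

/-- The absolute Cauchy kernel `|y₂ - p₂| / |y - p|²`. -/
def cauchyKer (p y : Plane) : ℝ := |y.2 - p.2| / ((y.1 - p.1) ^ 2 + (y.2 - p.2) ^ 2)

lemma cauchyKer_nonneg (p y : Plane) : 0 ≤ cauchyKer p y := by unfold cauchyKer; positivity

lemma measurable_cauchyKer (p : Plane) : Measurable (cauchyKer p) := by
  unfold cauchyKer
  exact (by fun_prop : Measurable fun y : Plane => |y.2 - p.2|).div (by fun_prop)

/-- This is the Poisson kernel of the half-plane up to the factor `π`, so its mass is `π` at every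
height `b ≠ 0`; at `b = 0` the integrand is zero by the convention on division. -/
lemma cauchyKer_slice (a b : ℝ) :
    Integrable (fun s : ℝ => |b| / ((s - a) ^ 2 + b ^ 2)) ∧
      ∫ s : ℝ, |b| / ((s - a) ^ 2 + b ^ 2) ≤ Real.pi := by
  rcases eq_or_ne b 0 with rfl | hb
  · simp [Real.pi_pos.le]
  have hb' : 0 < |b| := abs_pos.2 hb
  have e : (fun s : ℝ => |b| / ((s - a) ^ 2 + b ^ 2))
      = fun s => |b|⁻¹ * (fun z : ℝ => (1 + (z / |b|) ^ 2)⁻¹) (s - a) := by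
    ext s
    have : b ^ 2 = |b| ^ 2 := (sq_abs b).symm
    simp only
    rw [this]
    field_simp
    ring
  have hi : Integrable (fun z : ℝ => (1 + (z / |b|) ^ 2)⁻¹) :=
    integrable_inv_one_add_sq.comp_div hb'.ne'
  rw [e]
  refine ⟨(hi.comp_sub_right a).const_mul _, le_of_eq ?_⟩
  rw [integral_const_mul, integral_sub_right_eq_self (fun z : ℝ => (1 + (z / |b|) ^ 2)⁻¹) a,
    Measure.integral_comp_div (fun z : ℝ => (1 + z ^ 2)⁻¹) |b|, integral_univ_inv_one_add_sq,
    abs_abs, smul_eq_mul]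
  field_simp

/-- Tonelli, integrating in `y₁` first: each horizontal line costs at most `π`, whatever its
distance to `p`, so only a one-dimensional integral of the weight remains. -/
lemma cauchyKer_strip (p : Plane) {h : ℝ → ℝ} {s : Set ℝ} (hm : Measurable h)
    (h0 : ∀ z, 0 ≤ h z) (hi : IntegrableOn h s) :
    IntegrableOn (fun y => cauchyKer p y * h y.2) (univ ×ˢ s) ∧
      ∫ y in univ ×ˢ s, cauchyKer p y * h y.2 ≤ Real.pi * ∫ z in s, h z := by
  have hinner : ∀ z, ∫ x : ℝ, cauchyKer p (x, z) * h z ≤ Real.pi * h z := fun z => by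
    rw [integral_mul_const]
    exact mul_le_mul_of_nonneg_right (cauchyKer_slice p.1 (z - p.2)).2 (h0 z)
  have hnn : ∀ z, 0 ≤ ∫ x : ℝ, cauchyKer p (x, z) * h z := fun z =>
    integral_nonneg fun x => mul_nonneg (cauchyKer_nonneg _ _) (h0 z)
  have hmeas : Measurable (fun y : Plane => cauchyKer p y * h y.2) :=
    (measurable_cauchyKer p).mul (hm.comp measurable_snd)
  have hr : (volume : Measure Plane).restrict (univ ×ˢ s)
      = (volume : Measure ℝ).prod (volume.restrict s) := by
    rw [Measure.volume_eq_prod, ← Measure.prod_restrict, Measure.restrict_univ]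
  have hsm : StronglyMeasurable (fun z => ∫ x : ℝ, cauchyKer p (x, z) * h z) :=
    (hmeas.stronglyMeasurable).integral_prod_left'
  have hii : Integrable (fun z => ∫ x : ℝ, cauchyKer p (x, z) * h z) (volume.restrict s) :=
    (hi.const_mul Real.pi).mono' hsm.aestronglyMeasurable
      (Eventually.of_forall fun z => by rw [Real.norm_of_nonneg (hnn z)]; exact hinner z)
  have hI : Integrable (fun y => cauchyKer p y * h y.2)
      ((volume : Measure ℝ).prod (volume.restrict s)) := by
    refine (integrable_prod_iff' hmeas.aestronglyMeasurable).2 ⟨Eventually.of_forall fun z => ?_, ?_⟩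
    · exact ((cauchyKer_slice p.1 (z - p.2)).1.mul_const (h z) :)
    · refine hii.congr (Eventually.of_forall fun z => integral_congr_ae (Eventually.of_forall
        fun x => ?_))
      exact (Real.norm_of_nonneg (mul_nonneg (cauchyKer_nonneg _ _) (h0 z))).symm
  refine ⟨by rwa [IntegrableOn, hr], ?_⟩
  rw [hr, integral_prod_symm _ hI, ← integral_const_mul]
  exact integral_mono hii (hi.const_mul Real.pi) hinner

/-! ### Elementary facts on the kernels -/

lemma G11_eq (x y : Plane) : G11 x y = y.1 * (y.2 - x.2) /
    (((y.1 - x.1) ^ 2 + (y.2 - x.2) ^ 2) * ((y.1 + x.1) ^ 2 + (y.2 - x.2) ^ 2)) := by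
  simp [G11, lenSq, til]

/-- Reflection in the horizontal axis lets integrability and far-field estimates for `G11` serve
both kernels, provided they assume no sign for `x.2`. -/
lemma G12_eq (x y : Plane) : G12 x y = G11 (bar x) y := by
  rw [G11_eq]
  simp only [G12, lenSq, bar, Prod.fst_add, Prod.snd_add, Prod.fst_sub, Prod.snd_sub]
  rw [mul_comm ((y.1 + x.1) ^ 2 + (y.2 + x.2) ^ 2)]
  simp only [sub_neg_eq_add]

lemma K2_eq_swap (x y : Plane) : K2 x y = K1 x.swap y.swap := by
  simp only [K2, K1, G11, G12, G21, G22, lenSq, til, bar, Prod.fst_add, Prod.snd_add,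
    Prod.fst_sub, Prod.snd_sub, Prod.fst_swap, Prod.snd_swap]
  rw [add_comm, mul_comm ((y.1 + x.1) ^ 2 + (y.2 + x.2) ^ 2)]
  congr 2 <;> ring

lemma measurable_G11 (x : Plane) : Measurable (G11 x) := by
  have : G11 x = fun y => _ := funext (G11_eq x)
  rw [this]
  exact (by fun_prop : Measurable fun y : Plane => y.1 * (y.2 - x.2)).div (by fun_prop)

lemma abs_G11_eq {x y : Plane} (hy : 0 ≤ y.1) : |G11 x y| =
    cauchyKer x y * (y.1 / ((y.1 + x.1) ^ 2 + (y.2 - x.2) ^ 2)) := by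
  rw [G11_eq, cauchyKer, abs_div, abs_mul, abs_of_nonneg hy,
    abs_of_nonneg (a := _ * _) (by positivity), div_mul_div_comm, mul_comm |_|]

/-- A weighted bound: the weight `w` absorbs the second factor of the kernel. -/
lemma abs_G11_mul_le {x y : Plane} (hy : 0 ≤ y.1) {w B : ℝ}
    (hw : y.2 ≠ x.2 → y.1 * |w| ≤ B * ((y.1 + x.1) ^ 2 + (y.2 - x.2) ^ 2)) :
    |G11 x y * w| ≤ cauchyKer x y * B := by
  rcases eq_or_ne y.2 x.2 with h | h
  · rw [G11_eq, cauchyKer, h]; simp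
  have h2 : 0 < (y.2 - x.2) ^ 2 := by have := sub_ne_zero.2 h; positivity
  rw [abs_mul, abs_G11_eq hy, mul_assoc]
  refine mul_le_mul_of_nonneg_left ?_ (cauchyKer_nonneg _ _)
  rw [div_mul_eq_mul_div, div_le_iff₀ (by positivity)]
  exact hw h

/-- Integrability of the kernel against a function vanishing linearly on the axis `y₁ = 0`. -/
lemma integrableOn_G11_mul {x : Plane} (hx : 0 ≤ x.1) {f : Plane → ℝ} (hf : Continuous f) {L r : ℝ}
    (hL : ∀ y ∈ box r, |f y| ≤ L * y.1) : IntegrableOn (fun y => G11 x y * f y) (box r) := by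
  have hst := (cauchyKer_strip x (h := fun _ => |L|) (s := Icc 0 r) measurable_const
    (fun _ => abs_nonneg _) (by simp)).1
  have hsub : box r ⊆ univ ×ˢ Icc 0 r := by rw [box_eq_prod]; exact prod_mono (subset_univ _) le_rfl
  refine Integrable.mono' (hst.mono_set hsub)
    ((measurable_G11 x).mul hf.measurable).aestronglyMeasurable ?_
  refine (ae_restrict_iff' (measurableSet_box r)).2 (Eventually.of_forall fun y hy => ?_)
  have hy1 := (mem_box.1 hy).1.1
  refine abs_G11_mul_le hy1 fun _ => ?_
  have h1 : |f y| ≤ |L| * y.1 := (hL y hy).trans (by gcongr; exact le_abs_self L)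
  calc y.1 * |f y| ≤ y.1 * (|L| * y.1) := by gcongr
    _ = |L| * (y.1 ^ 2) := by ring
    _ ≤ _ := by gcongr; nlinarith [sq_nonneg (y.2 - x.2)]

/-- A `C¹` function vanishing on the axis `y₁ = 0` vanishes there linearly. -/
lemma exists_linear_bound {f : Plane → ℝ} (hf : ContDiff ℝ 1 f) (h0 : ∀ z, f (0, z) = 0) (r : ℝ) :
    ∃ L, ∀ y ∈ box r, |f y| ≤ L * y.1 := by
  have hc : Continuous (d1 f) := (contDiff_d1 (m := 0) hf (by norm_num)).continuous
  obtain ⟨L, hL⟩ := (isCompact_box r).exists_bound_of_continuousOn hc.continuousOn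
  refine ⟨L, fun y hy => ?_⟩
  obtain ⟨⟨h1, h2⟩, h3, h4⟩ := mem_box.1 hy
  have hd : ∀ s ∈ Icc 0 y.1, HasDerivWithinAt (fun s => f (s, y.2)) (d1 f (s, y.2))
      (Icc 0 y.1) s := fun s _ =>
    (((hf.differentiable one_ne_zero (s, y.2)).hasFDerivAt).comp_hasDerivAt s
      ((hasDerivAt_id s).prodMk (hasDerivAt_const s y.2))).hasDerivWithinAt
  have := norm_image_sub_le_of_norm_deriv_le_segment' hd
    (fun s hs => hL (s, y.2) (mem_box.2 ⟨⟨hs.1, hs.2.le.trans h2⟩, h3, h4⟩)) y.1 ⟨h1, le_rfl⟩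
  simpa [h0] using this

lemma integrableOn_K1_mul {x : Plane} (hx : 0 ≤ x.1) {f : Plane → ℝ} (hf : ContDiff ℝ 1 f)
    (h0 : ∀ z, f (0, z) = 0) (r : ℝ) : IntegrableOn (fun y => K1 x y * f y) (box r) := by
  obtain ⟨L, hL⟩ := exists_linear_bound hf h0 r
  have h1 := integrableOn_G11_mul hx hf.continuous hL
  have h2 := integrableOn_G11_mul (x := bar x) hx hf.continuous hL
  refine (h1.add h2).congr (Eventually.of_forall fun y => ?_)
  simp [K1, G12_eq, add_mul]

/-! ### The near part -/

lemma rpow_mul_rpow_le {a b Q α : ℝ} (ha : 0 ≤ a) (hb : 0 ≤ b) (h0 : 0 ≤ α) (h2 : α ≤ 2)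
    (haQ : a ^ 2 ≤ Q) (hbQ : b ^ 2 ≤ Q) : a ^ (2 - α) * b ^ α ≤ Q := by
  have hQ : 0 ≤ Q := (sq_nonneg a).trans haQ
  have e : Q = √Q ^ (2 - α) * √Q ^ α := by
    rw [← Real.rpow_add_of_nonneg (Real.sqrt_nonneg _) (by linarith) h0]
    norm_num [Real.sq_sqrt hQ]
  have h1 : a ≤ √Q := Real.le_sqrt_of_sq_le haQ
  have h3 : b ≤ √Q := Real.le_sqrt_of_sq_le hbQ
  rw [e]
  exact mul_le_mul (Real.rpow_le_rpow ha h1 (by linarith)) (Real.rpow_le_rpow hb h3 h0)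
    (by positivity) (by positivity)

lemma integral_abs_sub_rpow {α c : ℝ} (h1 : α < 1) (hc : 0 ≤ c) :
    IntegrableOn (fun z : ℝ => |z - c| ^ (-α)) (Icc 0 c) ∧
      ∫ z in Icc 0 c, |z - c| ^ (-α) = c ^ (1 - α) / (1 - α) := by
  have hI : IntervalIntegrable (fun z : ℝ => z ^ (-α)) volume 0 c :=
    intervalIntegral.intervalIntegrable_rpow' (by linarith)
  have hI2 := (hI.comp_sub_left c).symm
  simp only [sub_self, sub_zero] at hI2
  have heq : EqOn (fun z : ℝ => (c - z) ^ (-α)) (fun z : ℝ => |z - c| ^ (-α)) (Ioc 0 c) := by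
    intro z hz
    simp only
    rw [abs_sub_comm, abs_of_nonneg (by linarith [hz.2])]
  constructor
  · rw [integrableOn_Icc_iff_integrableOn_Ioc]
    exact ((intervalIntegrable_iff_integrableOn_Ioc_of_le hc).1 hI2).congr_fun heq
      measurableSet_Ioc
  · rw [integral_Icc_eq_integral_Ioc, ← setIntegral_congr_fun measurableSet_Ioc heq,
      ← intervalIntegral.integral_of_le hc,
      intervalIntegral.integral_comp_sub_left (fun z => z ^ (-α)) c, sub_self, sub_zero,
      integral_rpow (Or.inl (by linarith)), Real.zero_rpow (by linarith), sub_zero]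
    congr 1 <;> ring_nf

/-- The only negative contribution to the near part comes from the strip `y₂ < x₂`. -/
lemma near_lower {x : Plane} (hx1 : 0 ≤ x.1) (hx2 : 0 ≤ x.2) {f : Plane → ℝ} (hf : ContDiff ℝ 1 f)
    (hz : ∀ z, f (0, z) = 0) {N α D : ℝ} (hα0 : 0 < α) (hα1 : α < 1) (hN : 0 ≤ N) (hD : 0 ≤ D)
    (hf0 : ∀ y ∈ box 1, 0 ≤ f y) (hfN : ∀ y ∈ box 1, f y ≤ N)
    (hfD : ∀ y ∈ box (max x.1 x.2), f y ≤ D * y.1 ^ (1 - α)) :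
    (∫ y in box 1, G12 x y * f y) - Real.pi * (D * (x.2 ^ (1 - α) / (1 - α)) + N)
      ≤ ∫ y in box 1, K1 x y * f y := by
  obtain ⟨L, hL⟩ := exists_linear_bound hf hz 1
  have i12 : IntegrableOn (fun y => G12 x y * f y) (box 1) := by
    simp only [G12_eq]
    exact integrableOn_G11_mul (x := bar x) hx1 hf.continuous hL
  have iK := integrableOn_K1_mul hx1 hf hz 1
  set r := max x.1 x.2 with hr
  have hr0 : 0 ≤ r := hx1.trans (le_max_left _ _)
  obtain ⟨ia, ea⟩ := integral_abs_sub_rpow hα1 hx2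
  -- The first term pays for `y₁ ≤ r`, the second for `y₁ > r`. Since the strip has height `x.2 ≤
  -- r`, the second integrates to at most `N`. For `r = 0` the quotient is `0`, which is harmless:
  -- the strip is then a line where `G11` vanishes.
  set h : ℝ → ℝ := fun z => D * |z - x.2| ^ (-α) + N / r with hh
  have hm : Measurable h := by fun_prop
  have h0 : ∀ z, 0 ≤ h z := fun z => by positivity
  have hic : IntegrableOn (fun _ : ℝ => N / r) (Icc 0 x.2) := by simp
  have hi : IntegrableOn h (Icc 0 x.2) := (ia.const_mul D).add hic
  have he : ∫ z in Icc 0 x.2, h z ≤ D * (x.2 ^ (1 - α) / (1 - α)) + N := by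
    rw [integral_add (ia.const_mul D) hic, integral_const_mul, ea, setIntegral_const, smul_eq_mul]
    have : volume.real (Icc 0 x.2) * (N / r) ≤ N := by
      rw [Real.volume_real_Icc_of_le hx2, sub_zero, mul_div_assoc', mul_comm, mul_div_assoc]
      exact mul_le_of_le_one_right hN (div_le_one_of_le₀ (le_max_right _ _) hr0)
    linarith
  obtain ⟨is, es⟩ := cauchyKer_strip x hm h0 hi
  have hms : MeasurableSet ((univ : Set ℝ) ×ˢ Icc 0 x.2) := MeasurableSet.univ.prod measurableSet_Icc
  have iind := (integrable_indicator_iff hms).2 is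
  have hle : ∫ y in box 1, indicator (univ ×ˢ Icc 0 x.2) (fun y => cauchyKer x y * h y.2) y
      ≤ Real.pi * (D * (x.2 ^ (1 - α) / (1 - α)) + N) := by
    refine (setIntegral_le_integral iind (Eventually.of_forall fun y =>
      indicator_nonneg (fun y _ => mul_nonneg (cauchyKer_nonneg _ _) (h0 _)) y)).trans ?_
    rw [integral_indicator hms]
    exact es.trans (mul_le_mul_of_nonneg_left he Real.pi_pos.le)
  refine le_trans (sub_le_sub_left hle _) ?_
  rw [← integral_sub i12 iind.integrableOn]
  refine setIntegral_mono_on (i12.sub iind.integrableOn) iK (measurableSet_box 1) fun y hy => ?_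
  have fy0 := hf0 y hy
  obtain ⟨⟨hy1, -⟩, hy2, -⟩ := mem_box.1 hy
  have key : -indicator (univ ×ˢ Icc 0 x.2) (fun y => cauchyKer x y * h y.2) y ≤ G11 x y * f y := by
    rcases lt_or_ge x.2 y.2 with hlt | hge
    · rw [indicator_of_notMem (fun hmem => by linarith [hmem.2.2]), neg_zero]
      refine mul_nonneg ?_ fy0
      rw [G11_eq]
      have : 0 ≤ y.2 - x.2 := by linarith
      positivity
    · rw [indicator_of_mem (show y ∈ univ ×ˢ Icc 0 x.2 from ⟨mem_univ _, hy2, hge⟩)]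
      refine neg_le_of_abs_le (abs_G11_mul_le hy1 fun hne => ?_)
      have hx2' : 0 < x.2 := by
        rcases hx2.eq_or_lt with h' | h'
        · exact absurd (le_antisymm hge (h' ▸ hy2)) hne
        · exact h'
      have hr0' : 0 < r := hx2'.trans_le (le_max_right _ _)
      have hb : 0 < |y.2 - x.2| := abs_pos.2 (sub_ne_zero.2 hne)
      rw [abs_of_nonneg fy0]
      set Q := (y.1 + x.1) ^ 2 + (y.2 - x.2) ^ 2 with hQ
      have hQ1 : y.1 ^ 2 ≤ Q := by nlinarith [sq_nonneg (y.2 - x.2)]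
      have hQ2 : |y.2 - x.2| ^ 2 ≤ Q := by rw [sq_abs]; nlinarith [sq_nonneg (y.1 + x.1)]
      have hQ0 : 0 ≤ Q := (sq_nonneg _).trans hQ1
      rcases le_or_gt y.1 r with hle | hgt
      · have hfy := hfD y (mem_box.2 ⟨⟨hy1, hle⟩, hy2, hge.trans (le_max_right _ _)⟩)
        have e1 : y.1 * y.1 ^ (1 - α) = y.1 ^ (2 - α) := by
          rw [show (2 - α) = 1 + (1 - α) by ring,
            Real.rpow_add_of_nonneg hy1 zero_le_one (by linarith), Real.rpow_one]
        have e2 : y.1 ^ (2 - α) ≤ |y.2 - x.2| ^ (-α) * Q := by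
          rw [Real.rpow_neg hb.le, inv_mul_eq_div, le_div_iff₀ (by positivity)]
          exact rpow_mul_rpow_le hy1 hb.le hα0.le (by linarith) hQ1 hQ2
        calc y.1 * f y ≤ y.1 * (D * y.1 ^ (1 - α)) := by gcongr
          _ = D * (y.1 * y.1 ^ (1 - α)) := by ring
          _ ≤ D * (|y.2 - x.2| ^ (-α) * Q) := by rw [e1]; gcongr
          _ ≤ h y.2 * Q := by
            have : 0 ≤ N / r * Q := by positivity
            simp only [hh]; linarith
      · have hfy := hfN y hy
        calc y.1 * f y ≤ y.1 * N := by gcongr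
          _ ≤ N / r * y.1 ^ 2 := by
            rw [div_mul_eq_mul_div, le_div_iff₀ hr0']
            nlinarith [mul_nonneg hy1 hN]
          _ ≤ N / r * Q := by gcongr
          _ ≤ h y.2 * Q := by
            have : 0 ≤ D * |y.2 - x.2| ^ (-α) * Q := by positivity
            simp only [hh]; linarith
  simp only [K1, add_mul]
  linarith

lemma M_nonneg (α : ℝ) (f : Plane → ℝ) (x : Plane) : 0 ≤ M α f x := by
  refine Real.sSup_nonneg ?_
  rintro _ ⟨y, -, rfl⟩
  exact (abs_nonneg _).trans (le_max_left _ _)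

/-- The weighted gradient bound gives Hölder decay at the axis `y₁ = 0`. -/
lemma le_M_mul_rpow {f : Plane → ℝ} (hf : ContDiff ℝ 1 f) (hz : ∀ z, f (0, z) = 0) {α : ℝ}
    (hα0 : 0 < α) (hα1 : α < 1) {x y : Plane} (hy : y ∈ box (max x.1 x.2)) :
    f y ≤ M α f x / (1 - α) * y.1 ^ (1 - α) := by
  have c1 : Continuous (d1 f) := (contDiff_d1 (m := 0) hf (by norm_num)).continuous
  have c2 : Continuous (d2 f) := (contDiff_d2 (m := 0) hf (by norm_num)).continuous
  have hcont : Continuous (fun y : Plane => max |y.1 ^ α * d1 f y| |y.2 ^ α * d2 f y|) := by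
    have r1 : Continuous fun y : Plane => y.1 ^ α := continuous_fst.rpow_const fun _ => Or.inr hα0.le
    have r2 : Continuous fun y : Plane => y.2 ^ α := continuous_snd.rpow_const fun _ => Or.inr hα0.le
    exact (r1.mul c1).abs.max (r2.mul c2).abs
  -- Boundedness is what makes `M` an actual supremum rather than the default value; `α > 0` makes
  -- the weights continuous up to the axes.
  have hbdd := (isCompact_box (max x.1 x.2)).bddAbove_image hcont.continuousOn
  obtain ⟨⟨h1, h2⟩, h3, h4⟩ := mem_box.1 hy
  have hd : ∀ s : ℝ, HasDerivAt (fun s => f (s, y.2)) (d1 f (s, y.2)) s := fun s =>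
    ((hf.differentiable one_ne_zero (s, y.2)).hasFDerivAt).comp_hasDerivAt s
      ((hasDerivAt_id s).prodMk (hasDerivAt_const s y.2))
  have hcs : Continuous fun s : ℝ => d1 f (s, y.2) := c1.comp (by fun_prop)
  have ftc := intervalIntegral.integral_eq_sub_of_hasDerivAt (fun s _ => hd s)
    (hcs.intervalIntegrable 0 y.1)
  rw [hz, sub_zero] at ftc
  have hI : IntervalIntegrable (fun z : ℝ => M α f x * z ^ (-α)) volume 0 y.1 :=
    (intervalIntegral.intervalIntegrable_rpow' (by linarith)).const_mul _
  have : ∫ s in (0 : ℝ)..y.1, d1 f (s, y.2) ≤ ∫ s in (0 : ℝ)..y.1, M α f x * s ^ (-α) := by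
    refine intervalIntegral.integral_mono_on_of_le_Ioo h1 (hcs.intervalIntegrable 0 y.1) hI
      fun s hs => ?_
    have hM : |s ^ α * d1 f (s, y.2)| ≤ M α f x := (le_max_left _ _).trans
      (le_csSup hbdd ⟨(s, y.2), mem_box.2 ⟨⟨hs.1.le, hs.2.le.trans h2⟩, h3, h4⟩, rfl⟩)
    rw [Real.rpow_neg hs.1.le, ← div_eq_mul_inv, le_div_iff₀ (Real.rpow_pos_of_pos hs.1 _), mul_comm]
    exact (le_abs_self _).trans hM
  have hev : ∫ s in (0 : ℝ)..y.1, M α f x * s ^ (-α) = M α f x / (1 - α) * y.1 ^ (1 - α) := by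
    rw [intervalIntegral.integral_const_mul, integral_rpow (Or.inl (by linarith)),
      Real.zero_rpow (by linarith), sub_zero, show -α + 1 = 1 - α by ring]
    ring
  have e : f (y.1, y.2) = f y := rfl
  rw [← e]
  linarith

/-! ### Logarithmic growth of the main term -/

/-- The dyadic square `(2^{-(k+1)}, 2^{-k}]²`. -/
def dyadicSq (k : ℕ) : Set Plane :=
  Ioc ((1 / 2 : ℝ) ^ (k + 1)) ((1 / 2) ^ k) ×ˢ Ioc ((1 / 2 : ℝ) ^ (k + 1)) ((1 / 2) ^ k)

lemma measurableSet_dyadicSq (k : ℕ) : MeasurableSet (dyadicSq k) :=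
  measurableSet_Ioc.prod measurableSet_Ioc

lemma dyadicSq_subset (k : ℕ) : dyadicSq k ⊆ box 1 := fun y hy => by
  have h1 : (0 : ℝ) < (1 / 2) ^ (k + 1) := by positivity
  have h2 : (1 / 2 : ℝ) ^ k ≤ 1 := pow_le_one₀ (by norm_num) (by norm_num)
  exact mem_box.2 ⟨⟨(h1.trans hy.1.1).le, hy.1.2.trans h2⟩, (h1.trans hy.2.1).le, hy.2.2.trans h2⟩

lemma disjoint_dyadicSq : Pairwise (Function.onFun Disjoint dyadicSq) := by
  intro k l hkl
  have hanti : Antitone fun n : ℕ => (1 / 2 : ℝ) ^ n :=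
    fun _ _ h => pow_le_pow_of_le_one (by norm_num) (by norm_num) h
  have := hanti.pairwise_disjoint_on_Ioc_succ hkl
  exact Disjoint.set_prod_left this _ _

lemma volume_dyadicSq (k : ℕ) : volume.real (dyadicSq k) = ((1 / 2) ^ k) ^ 2 / 4 := by
  have h : (1 / 2 : ℝ) ^ (k + 1) ≤ (1 / 2) ^ k :=
    pow_le_pow_of_le_one (by norm_num) (by norm_num) (by omega)
  rw [dyadicSq, Measure.volume_eq_prod, measureReal_prod_prod, Real.volume_real_Ioc_of_le h]
  ring

/-- The numerator is at least `s²/4` and the denominator at most `(9/2)(13/4) s⁴`, which gives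
`1/(58.5 s²)`. -/
lemma G12_lower {s : ℝ} (hs : 0 < s) {x y : Plane} (hx1 : 0 ≤ x.1) (hx1' : x.1 ≤ s / 2)
    (hx2 : 0 ≤ x.2) (hx2' : x.2 ≤ s / 2) (hy1 : s / 2 < y.1) (hy1' : y.1 ≤ s) (hy2 : s / 2 < y.2)
    (hy2' : y.2 ≤ s) : 1 / (60 * s ^ 2) ≤ G12 x y := by
  have e : G12 x y = y.1 * (y.2 + x.2) /
      (((y.1 + x.1) ^ 2 + (y.2 + x.2) ^ 2) * ((y.1 - x.1) ^ 2 + (y.2 + x.2) ^ 2)) := by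
    simp [G12, lenSq, bar]
  have a1 : (y.1 + x.1) ^ 2 ≤ (3 * s / 2) ^ 2 := by gcongr <;> linarith
  have a2 : (y.2 + x.2) ^ 2 ≤ (3 * s / 2) ^ 2 := by gcongr <;> linarith
  have a3 : (y.1 - x.1) ^ 2 ≤ s ^ 2 := by apply pow_le_pow_left₀ <;> linarith
  have a4 : 0 < (y.2 + x.2) ^ 2 := by have : 0 < y.2 + x.2 := by linarith
                                      positivity
  have a5 : (s / 2) * (s / 2) ≤ y.1 * (y.2 + x.2) :=
    mul_le_mul (by linarith) (by linarith) (by linarith) (by linarith)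
  have a6 : ((y.1 + x.1) ^ 2 + (y.2 + x.2) ^ 2) * ((y.1 - x.1) ^ 2 + (y.2 + x.2) ^ 2)
      ≤ (9 / 2 * s ^ 2) * (13 / 4 * s ^ 2) := by
    gcongr <;> nlinarith
  rw [e, div_le_div_iff₀ (by positivity) (by positivity)]
  nlinarith [mul_le_mul_of_nonneg_right a5 (by positivity : 0 ≤ 60 * s ^ 2), pow_pos hs 4]

/-- Each dyadic square with `k < n` has area `s²/4` and loses at most `s²/32` to the defect set, so
`f = N` on area at least `s²/8`. With `G12 ≥ 1/(60 s²)` there, scale invariance gives the same gain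
`N/480` from every square. -/
lemma main_lower {x : Plane} (hx1 : 0 ≤ x.1) (hx2 : 0 ≤ x.2) {f : Plane → ℝ} (hf : ContDiff ℝ 1 f)
    (hz : ∀ z, f (0, z) = 0) {N : ℝ} (hN : 0 ≤ N) (hf0 : ∀ y ∈ box 1, 0 ≤ f y) {n : ℕ}
    (hxn1 : x.1 ≤ (1 / 2) ^ n) (hxn2 : x.2 ≤ (1 / 2) ^ n)
    (htop : volume.real (box 1 \ {y | f y = N}) ≤ ((1 / 2) ^ n) ^ 2 / 8) :
    n * (N / 480) ≤ ∫ y in box 1, G12 x y * f y := by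
  obtain ⟨L, hL⟩ := exists_linear_bound hf hz 1
  have i12 : IntegrableOn (fun y => G12 x y * f y) (box 1) := by
    simp only [G12_eq]
    exact integrableOn_G11_mul (x := bar x) hx1 hf.continuous hL
  have ifx : IntegrableOn f (box 1) := hf.continuous.continuousOn.integrableOn_compact
    (isCompact_box 1)
  have hnn : ∀ y ∈ box 1, 0 ≤ G12 x y * f y := fun y hy => by
    obtain ⟨⟨hy1, -⟩, hy2, -⟩ := mem_box.1 hy
    refine mul_nonneg ?_ (hf0 y hy)
    simp only [G12, lenSq]
    positivity
  have hmN : MeasurableSet {y | f y = N} := measurableSet_eq_fun hf.continuous.measurable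
    measurable_const
  have hfinbox : volume (box 1) ≠ ⊤ := by rw [volume_box_one]; simp
  have piece : ∀ k ∈ Finset.range n, N / 480 ≤ ∫ y in dyadicSq k, G12 x y * f y := by
    intro k hk
    have hkn : k + 1 ≤ n := Finset.mem_range.1 hk
    set s : ℝ := (1 / 2) ^ k with hs
    have hs0 : 0 < s := by positivity
    have hs2 : (1 / 2 : ℝ) ^ (k + 1) = s / 2 := by rw [hs]; ring
    have hns : (1 / 2 : ℝ) ^ n ≤ s / 2 := by
      rw [← hs2]; exact pow_le_pow_of_le_one (by norm_num) (by norm_num) hkn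
    have hpn : (0 : ℝ) < (1 / 2) ^ n := by positivity
    have hsub := dyadicSq_subset k
    have hfin : volume (dyadicSq k) ≠ ⊤ := measure_ne_top_of_subset hsub hfinbox
    have hvol : s ^ 2 / 8 ≤ volume.real (dyadicSq k ∩ {y | f y = N}) := by
      have h1 := measureReal_inter_add_sdiff (μ := volume) (s := dyadicSq k) hmN hfin
      have h2 : volume.real (dyadicSq k \ {y | f y = N}) ≤ volume.real (box 1 \ {y | f y = N}) :=
        measureReal_mono (sdiff_subset_sdiff_left hsub)
          (measure_ne_top_of_subset sdiff_subset hfinbox)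
      rw [volume_dyadicSq] at h1
      nlinarith
    have hint : N * (s ^ 2 / 8) ≤ ∫ y in dyadicSq k, f y := by
      calc N * (s ^ 2 / 8) ≤ N * volume.real (dyadicSq k ∩ {y | f y = N}) := by gcongr
        _ = ∫ y in dyadicSq k ∩ {y | f y = N}, f y := by
          rw [setIntegral_congr_fun (g := fun _ => N)
            ((measurableSet_dyadicSq k).inter hmN) (fun y hy => hy.2), setIntegral_const,
            smul_eq_mul, mul_comm]
        _ ≤ ∫ y in dyadicSq k, f y := setIntegral_mono_set (ifx.mono_set hsub)
          ((ae_restrict_iff' (measurableSet_dyadicSq k)).2 (Eventually.of_forall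
            fun y hy => hf0 y (hsub hy))) (inter_subset_left.eventuallyLE)
    calc N / 480 = 1 / (60 * s ^ 2) * (N * (s ^ 2 / 8)) := by field_simp; ring
      _ ≤ 1 / (60 * s ^ 2) * ∫ y in dyadicSq k, f y := by gcongr
      _ = ∫ y in dyadicSq k, 1 / (60 * s ^ 2) * f y := (integral_const_mul _ _).symm
      _ ≤ ∫ y in dyadicSq k, G12 x y * f y := by
        refine setIntegral_mono_on ((ifx.mono_set hsub).const_mul _) (i12.mono_set hsub)
          (measurableSet_dyadicSq k) fun y hy => ?_
        have hy' := hy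
        rw [dyadicSq, hs2] at hy'
        exact mul_le_mul_of_nonneg_right (G12_lower hs0 hx1 (hxn1.trans hns) hx2 (hxn2.trans hns)
          hy'.1.1 hy'.1.2 hy'.2.1 hy'.2.2) (hf0 y (hsub hy))
  calc n * (N / 480) = ∑ k ∈ Finset.range n, N / 480 := by simp
    _ ≤ ∑ k ∈ Finset.range n, ∫ y in dyadicSq k, G12 x y * f y := Finset.sum_le_sum piece
    _ = ∫ y in ⋃ k ∈ Finset.range n, dyadicSq k, G12 x y * f y :=
      (integral_biUnion_finset _ (fun k _ => measurableSet_dyadicSq k)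
        (fun k _ l _ h => disjoint_dyadicSq h)
        (fun k _ => i12.mono_set (dyadicSq_subset k))).symm
    _ ≤ _ := setIntegral_mono_set i12
      ((ae_restrict_iff' (measurableSet_box 1)).2 (Eventually.of_forall hnn))
      (iUnion₂_subset fun k _ => dyadicSq_subset k).eventuallyLE

/-! ### The far part -/

/-- The `y₁`-derivative of `G11 x`. -/
def G11deriv (x y : Plane) : ℝ :=
  ((y.2 - x.2) * (((y.1 - x.1) ^ 2 + (y.2 - x.2) ^ 2) * ((y.1 + x.1) ^ 2 + (y.2 - x.2) ^ 2)) -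
    y.1 * (y.2 - x.2) * (2 * (y.1 - x.1) * ((y.1 + x.1) ^ 2 + (y.2 - x.2) ^ 2) +
      ((y.1 - x.1) ^ 2 + (y.2 - x.2) ^ 2) * (2 * (y.1 + x.1)))) /
    (((y.1 - x.1) ^ 2 + (y.2 - x.2) ^ 2) * ((y.1 + x.1) ^ 2 + (y.2 - x.2) ^ 2)) ^ 2

lemma measurable_G11deriv (x : Plane) : Measurable (G11deriv x) := by
  unfold G11deriv
  exact Measurable.div (by fun_prop) (by fun_prop)

/-- Here `‖y‖` is the maximum norm. The larger coordinate of `y` is at least `1` and is shifted by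
at most `1/4`, so it keeps three quarters of its size, and `9/16 ≥ 1/2`. -/
lemma far_denominators {x y : Plane} (hx1 : 0 ≤ x.1) (hx1' : x.1 ≤ 1 / 4) (hx2 : |x.2| ≤ 1 / 4)
    (hy1 : 0 ≤ y.1) (hy2 : 0 ≤ y.2) (hy : 1 ≤ ‖y‖) :
    ‖y‖ ^ 2 / 2 ≤ (y.1 - x.1) ^ 2 + (y.2 - x.2) ^ 2 ∧
      ‖y‖ ^ 2 / 2 ≤ (y.1 + x.1) ^ 2 + (y.2 - x.2) ^ 2 := by
  rw [Prod.norm_def, Real.norm_of_nonneg hy1, Real.norm_of_nonneg hy2] at *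
  obtain ⟨h1, h2⟩ := abs_le.1 hx2
  rcases le_total y.1 y.2 with h | h
  · rw [max_eq_right h] at *
    have : (3 / 4 * y.2) ^ 2 ≤ (y.2 - x.2) ^ 2 := by apply pow_le_pow_left₀ <;> linarith
    constructor <;> nlinarith [sq_nonneg (y.1 - x.1), sq_nonneg (y.1 + x.1)]
  · rw [max_eq_left h] at *
    have : (3 / 4 * y.1) ^ 2 ≤ (y.1 - x.1) ^ 2 := by apply pow_le_pow_left₀ <;> linarith
    constructor <;> nlinarith [sq_nonneg (y.2 - x.2), mul_nonneg hy1 hx1]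

lemma far_bound_num {x y : Plane} (hx2 : |x.2| ≤ 1 / 4) (hy : 1 ≤ ‖y‖) :
    |y.2 - x.2| ≤ 5 / 4 * ‖y‖ := by
  have h2 : |y.2| ≤ ‖y‖ := norm_snd_le y
  have := abs_sub y.2 x.2
  linarith

lemma abs_G11_far {x y : Plane} (hx1 : 0 ≤ x.1) (hx1' : x.1 ≤ 1 / 4) (hx2 : |x.2| ≤ 1 / 4)
    (hy1 : 0 ≤ y.1) (hy2 : 0 ≤ y.2) (hy : 1 ≤ ‖y‖) : |G11 x y| ≤ 5 * y.1 / ‖y‖ ^ 3 := by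
  obtain ⟨hP, hQ⟩ := far_denominators hx1 hx1' hx2 hy1 hy2 hy
  have hb := far_bound_num hx2 hy
  have h0 : 0 < ‖y‖ := by linarith
  rw [G11_eq, abs_div, abs_mul, abs_of_nonneg hy1, abs_of_nonneg (a := _ * _) (by positivity)]
  calc _ ≤ y.1 * (5 / 4 * ‖y‖) / (‖y‖ ^ 2 / 2 * (‖y‖ ^ 2 / 2)) := by gcongr
    _ = 5 * y.1 / ‖y‖ ^ 3 := by field_simp; ring

/-- By `2ab ≤ a² + b²`, each derivative of a denominator factor, times `y₂ - x₂`, is bounded by that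
factor. The numerator is then at most `(5/4 + 2)‖y‖PQ`, and `PQ ≥ ‖y‖⁴/4`. -/
lemma abs_G11deriv_far {x y : Plane} (hx1 : 0 ≤ x.1) (hx1' : x.1 ≤ 1 / 4) (hx2 : |x.2| ≤ 1 / 4)
    (hy1 : 0 ≤ y.1) (hy2 : 0 ≤ y.2) (hy : 1 ≤ ‖y‖) : |G11deriv x y| ≤ 16 / ‖y‖ ^ 3 := by
  obtain ⟨hP, hQ⟩ := far_denominators hx1 hx1' hx2 hy1 hy2 hy
  have hb := far_bound_num hx2 hy
  have h0 : 0 < ‖y‖ := by linarith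
  have hy1' : y.1 ≤ ‖y‖ := (le_abs_self _).trans (norm_fst_le y)
  unfold G11deriv
  set P := (y.1 - x.1) ^ 2 + (y.2 - x.2) ^ 2 with hPd
  set Q := (y.1 + x.1) ^ 2 + (y.2 - x.2) ^ 2 with hQd
  have hP0 : 0 < P := lt_of_lt_of_le (by positivity) hP
  have hQ0 : 0 < Q := lt_of_lt_of_le (by positivity) hQ
  have k1 : |(y.2 - x.2) * (2 * (y.1 - x.1))| ≤ P := by
    rw [abs_le]; constructor <;>
      nlinarith [sq_nonneg (y.1 - x.1 + (y.2 - x.2)), sq_nonneg (y.1 - x.1 - (y.2 - x.2))]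
  have k2 : |(y.2 - x.2) * (2 * (y.1 + x.1))| ≤ Q := by
    rw [abs_le]; constructor <;>
      nlinarith [sq_nonneg (y.1 + x.1 + (y.2 - x.2)), sq_nonneg (y.1 + x.1 - (y.2 - x.2))]
  have num : |(y.2 - x.2) * (P * Q) -
      y.1 * (y.2 - x.2) * (2 * (y.1 - x.1) * Q + P * (2 * (y.1 + x.1)))| ≤ 4 * ‖y‖ * (P * Q) := by
    have e : (y.2 - x.2) * (P * Q) -
      y.1 * (y.2 - x.2) * (2 * (y.1 - x.1) * Q + P * (2 * (y.1 + x.1)))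
      = (y.2 - x.2) * (P * Q) - y.1 * (((y.2 - x.2) * (2 * (y.1 - x.1))) * Q
        + ((y.2 - x.2) * (2 * (y.1 + x.1))) * P) := by ring
    rw [e]
    refine (abs_sub _ _).trans ?_
    rw [abs_mul, abs_mul y.1, abs_of_nonneg hy1, abs_of_pos (mul_pos hP0 hQ0)]
    have s2 : |(y.2 - x.2) * (2 * (y.1 - x.1)) * Q + (y.2 - x.2) * (2 * (y.1 + x.1)) * P|
        ≤ P * Q + Q * P := by
      refine (abs_add_le _ _).trans ?_
      rw [abs_mul _ Q, abs_mul _ P, abs_of_pos hP0, abs_of_pos hQ0]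
      gcongr
    calc _ ≤ 5 / 4 * ‖y‖ * (P * Q) + ‖y‖ * (P * Q + Q * P) := by gcongr
      _ ≤ 4 * ‖y‖ * (P * Q) := by nlinarith [mul_pos h0 (mul_pos hP0 hQ0)]
  rw [abs_div, abs_of_pos (a := (P * Q) ^ 2) (by positivity)]
  calc _ ≤ 4 * ‖y‖ * (P * Q) / (P * Q) ^ 2 := by gcongr
    _ = 4 * ‖y‖ / (P * Q) := by field_simp
    _ ≤ 4 * ‖y‖ / (‖y‖ ^ 2 / 2 * (‖y‖ ^ 2 / 2)) := by gcongr
    _ = 16 / ‖y‖ ^ 3 := by field_simp; norm_num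

lemma hasDerivAt_G11 {x y : Plane} (hx1 : 0 ≤ x.1) (hx1' : x.1 ≤ 1 / 4) (hx2 : |x.2| ≤ 1 / 4)
    (hy1 : 1 ≤ y.1) (hy2 : 0 ≤ y.2) :
    HasDerivAt (fun s => G11 x (s, y.2)) (G11deriv x y) y.1 := by
  have hn : 1 ≤ ‖y‖ := hy1.trans ((le_abs_self _).trans (norm_fst_le y))
  obtain ⟨hP, hQ⟩ := far_denominators hx1 hx1' hx2 (by linarith) hy2 hn
  have hP0 := lt_of_lt_of_le (by positivity) hP
  have hQ0 := lt_of_lt_of_le (by positivity) hQ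
  simp only [G11_eq]
  have hid := hasDerivAt_id y.1
  have d1 : HasDerivAt (fun s => (s - x.1) ^ 2 + (y.2 - x.2) ^ 2) (2 * (y.1 - x.1)) y.1 := by
    simpa using ((hid.sub_const x.1).pow 2).add_const ((y.2 - x.2) ^ 2)
  have d2 : HasDerivAt (fun s => (s + x.1) ^ 2 + (y.2 - x.2) ^ 2) (2 * (y.1 + x.1)) y.1 := by
    simpa using ((hid.add_const x.1).pow 2).add_const ((y.2 - x.2) ^ 2)
  have d3 : HasDerivAt (fun s => s * (y.2 - x.2)) (y.2 - x.2) y.1 := by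
    simpa using hid.mul_const (y.2 - x.2)
  exact d3.div (d1.mul d2) (mul_pos hP0 hQ0).ne'

/-- The majorant of the far part. -/
def japanese (y : Plane) : ℝ := (1 + ‖y‖) ^ (-3 : ℝ)

lemma integrable_japanese : Integrable japanese :=
  integrable_one_add_norm (E := Plane) (r := 3) (by simp; norm_num)

lemma japanese_nonneg (y : Plane) : 0 ≤ japanese y := by unfold japanese; positivity

lemma inv_norm_cube_le {y : Plane} (hy : 1 ≤ ‖y‖) {c : ℝ} (hc : 0 ≤ c) (hc' : c ≤ 16) :
    c / ‖y‖ ^ 3 ≤ 128 * japanese y := by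
  have h0 : 0 < ‖y‖ := by linarith
  have e : japanese y = 1 / (1 + ‖y‖) ^ 3 := by
    rw [japanese, Real.rpow_neg (by positivity), one_div]; norm_cast
  rw [e, mul_one_div, div_le_div_iff₀ (by positivity) (by positivity)]
  -- This explains the constant: `128 = 16 · 2³`.
  have : (1 + ‖y‖) ^ 3 ≤ (2 * ‖y‖) ^ 3 := by gcongr; linarith
  nlinarith [pow_pos h0 3]

lemma tendsto_setIntegral_of_le_japanese {J : Plane → ℝ} (hJ : Measurable J) {E : ℝ → Set Plane}
    (hE : ∀ R, MeasurableSet (E R)) (hmono : Monotone E) {C : ℝ} (hC : 0 ≤ C)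
    (hb : ∀ R, ∀ y ∈ E R, |J y| ≤ C * japanese y) :
    (∀ R, IntegrableOn J (E R)) ∧ ∃ l, Tendsto (fun R => ∫ y in E R, J y) atTop (𝓝 l) ∧
      |l| ≤ C * ∫ y, japanese y := by
  have hU : MeasurableSet (⋃ R, E R) := by
    -- Monotonicity replaces the uncountable union by a countable one, which is measurable.
    have : (⋃ R, E R) = ⋃ n : ℕ, E n := by
      refine subset_antisymm (iUnion_subset fun R => ?_) (iUnion_subset fun n => subset_iUnion _ _)
      obtain ⟨n, hn⟩ := exists_nat_ge R
      exact (hmono hn).trans (subset_iUnion (fun n : ℕ => E n) n)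
    rw [this]
    exact MeasurableSet.iUnion fun n => hE n
  have hi : IntegrableOn J (⋃ R, E R) := by
    refine Integrable.mono' (integrable_japanese.const_mul C).integrableOn
      hJ.aestronglyMeasurable ((ae_restrict_iff' hU).2 (Eventually.of_forall fun y hy => ?_))
    obtain ⟨R, hR⟩ := mem_iUnion.1 hy
    exact hb R y hR
  refine ⟨fun R => hi.mono_set (subset_iUnion _ R), _,
    tendsto_setIntegral_of_monotone hE hmono hi, ?_⟩
  have hji := integrable_japanese.const_mul C
  calc |∫ y in ⋃ R, E R, J y| ≤ ∫ y in ⋃ R, E R, C * japanese y := by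
        rw [← Real.norm_eq_abs]
        refine norm_integral_le_of_norm_le hji.integrableOn
          ((ae_restrict_iff' hU).2 (Eventually.of_forall fun y hy => ?_))
        obtain ⟨R, hR⟩ := mem_iUnion.1 hy
        exact hb R y hR
    _ ≤ ∫ y, C * japanese y := setIntegral_le_integral hji
        (Eventually.of_forall fun y => mul_nonneg hC (japanese_nonneg y))
    _ = C * ∫ y, japanese y := integral_const_mul _ _

/-- The primitive in the first variable, normalized at `y₁ = 1`. -/
def primitive (f : Plane → ℝ) (y : Plane) : ℝ := ∫ s in (1 : ℝ)..y.1, f (s, y.2)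

lemma continuous_primitive {f : Plane → ℝ} (hf : Continuous f) : Continuous (primitive f) :=
  intervalIntegral.continuous_parametric_intervalIntegral_of_continuous
    (f := fun (y : Plane) s => f (s, y.2)) (by fun_prop) continuous_fst

/-- Oddness and periodicity give `f` zero mean over a period in `y₁`, so the primitive is itself
periodic; any endpoint can be moved into `[0, 2)`, within distance `1` of the base point. -/
lemma abs_primitive_le {f : Plane → ℝ} (hf : Continuous f) (hp : IsPeriodic f) (ho : IsDoubleOdd f)
    {N : ℝ} (hN : ∀ y, |f y| ≤ N) (y : Plane) : |primitive f y| ≤ N := by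
  set g : ℝ → ℝ := fun s => f (s, y.2) with hg
  have hgc : Continuous g := by fun_prop
  have hgp : Function.Periodic g 2 := fun s => (hp (s, y.2)).1
  have hz : ∀ t, ∫ s in t..t + 2, g s = 0 := by
    intro t
    rw [hgp.intervalIntegral_add_eq t (-1)]
    have h1 : ∫ s in (-1 : ℝ)..-1 + 2, g s = ∫ s in (-1 : ℝ)..1, g s := by norm_num
    have h2 : ∫ s in (-1 : ℝ)..1, g (-s) = ∫ s in (-1 : ℝ)..1, g s := by
      rw [intervalIntegral.integral_comp_neg]; norm_num
    have h3 : ∫ s in (-1 : ℝ)..1, g (-s) = -∫ s in (-1 : ℝ)..1, g s := by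
      rw [← intervalIntegral.integral_neg]
      exact intervalIntegral.integral_congr fun s _ => (ho (s, y.2)).1
    linarith
  have hFp : Function.Periodic (fun t => ∫ s in (1 : ℝ)..t, g s) 2 := by
    intro t
    have := intervalIntegral.integral_add_adjacent_intervals
      (hgc.intervalIntegrable (μ := volume) 1 t) (hgc.intervalIntegrable t (t + 2))
    simp only
    rw [← this, hz, add_zero]
  obtain ⟨t, ht, hte⟩ := hFp.exists_mem_Ico₀ two_pos y.1
  have : primitive f y = ∫ s in (1 : ℝ)..t, g s := hte
  rw [this]
  have hN0 : 0 ≤ N := (abs_nonneg _).trans (hN y)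
  have := intervalIntegral.norm_integral_le_of_norm_le_const
    (a := 1) (b := t) (f := g) (C := N) fun s _ => hN _
  refine this.trans (mul_le_of_le_one_right hN0 ?_)
  rw [abs_le]; constructor <;> linarith [ht.1, ht.2]

/-- On the strip `y₁ ≤ 1` the factor `y₁` already gives decay `‖y‖⁻³`. For `y₁ > 1`, integrating by
parts in `y₁` exchanges the vorticity for its bounded primitive and the kernel for its derivative,
of size `‖y‖⁻³`. The boundary term at `y₁ = 1` vanishes by the normalization, and the one at `y₁ =
R` is `O(R · R⁻²)`. -/
lemma far_G11 {x : Plane} (hx1 : 0 ≤ x.1) (hx1' : x.1 ≤ 1 / 4) (hx2 : |x.2| ≤ 1 / 4)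
    {f : Plane → ℝ} (hf : Continuous f) (hp : IsPeriodic f) (ho : IsDoubleOdd f) {N : ℝ}
    (hN : ∀ y, |f y| ≤ N) :
    ∃ l, Tendsto (fun R => ∫ y in box R \ box 1, G11 x y * f y) atTop (𝓝 l) ∧
      |l| ≤ 256 * N * ∫ y, japanese y := by
  have hN0 : 0 ≤ N := (abs_nonneg _).trans (hN 0)
  have hF := abs_primitive_le hf hp ho hN
  have hFc := continuous_primitive hf
  set E₁ : ℝ → Set Plane := fun R => Icc 0 1 ×ˢ Ioc 1 R with hE₁
  set E₂ : ℝ → Set Plane := fun R => Ioc 1 R ×ˢ Icc 0 R with hE₂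
  have m1 : ∀ R, MeasurableSet (E₁ R) := fun R => measurableSet_Icc.prod measurableSet_Ioc
  have m2 : ∀ R, MeasurableSet (E₂ R) := fun R => measurableSet_Ioc.prod measurableSet_Icc
  have mono1 : Monotone E₁ := fun _ _ h => prod_mono le_rfl (Ioc_subset_Ioc_right h)
  have mono2 : Monotone E₂ := fun _ _ h =>
    prod_mono (Ioc_subset_Ioc_right h) (Icc_subset_Icc_right h)
  have n1 : ∀ y : Plane, 1 ≤ y.2 → 1 ≤ ‖y‖ := fun y h =>
    h.trans ((le_abs_self _).trans (norm_snd_le y))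
  have n2 : ∀ y : Plane, 1 ≤ y.1 → 1 ≤ ‖y‖ := fun y h =>
    h.trans ((le_abs_self _).trans (norm_fst_le y))
  have mGf : Measurable (fun y => G11 x y * f y) := (measurable_G11 x).mul hf.measurable
  have mDF : Measurable (fun y => G11deriv x y * primitive f y) :=
    (measurable_G11deriv x).mul hFc.measurable
  obtain ⟨i1, l1, t1, b1⟩ := tendsto_setIntegral_of_le_japanese (C := 128 * N) mGf m1 mono1
    (by positivity) (by
      rintro R y ⟨⟨h1, h2⟩, h3, -⟩
      have hn := n1 y h3.le
      rw [abs_mul]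
      calc |G11 x y| * |f y| ≤ (128 * japanese y) * N := by
            have := (abs_G11_far hx1 hx1' hx2 h1 (by linarith) hn).trans
              (inv_norm_cube_le hn (by positivity) (by linarith))
            have := japanese_nonneg y
            gcongr
            exact hN y
        _ = _ := by ring)
  obtain ⟨i2, l2, t2, b2⟩ := tendsto_setIntegral_of_le_japanese (C := 128 * N) mDF m2 mono2
    (by positivity) (by
      rintro R y ⟨⟨h1, -⟩, h3, -⟩
      have hn := n2 y h1.le
      rw [abs_mul]
      calc |G11deriv x y| * |primitive f y| ≤ (128 * japanese y) * N := by
            have := (abs_G11deriv_far hx1 hx1' hx2 (by linarith) h3 hn).trans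
              (inv_norm_cube_le hn (by norm_num) le_rfl)
            have := japanese_nonneg y
            gcongr
            exact hF y
        _ = _ := by ring)
  have hG5 : ∀ y : Plane, 1 ≤ y.1 → 0 ≤ y.2 → |G11 x y| ≤ 5 / y.1 ^ 2 := by
    intro y h1 h2
    have hn := n2 y h1
    have hle : y.1 ≤ ‖y‖ := (le_abs_self _).trans (norm_fst_le y)
    refine (abs_G11_far hx1 hx1' hx2 (by linarith) h2 hn).trans ?_
    have h0 : 0 < y.1 := by linarith
    calc 5 * y.1 / ‖y‖ ^ 3 ≤ 5 * y.1 / y.1 ^ 3 := by gcongr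
      _ = 5 / y.1 ^ 2 := by field_simp
  have i3 : ∀ R, IntegrableOn (fun y => G11 x y * f y) (E₂ R) := by
    intro R
    have hfin : volume (E₂ R) < ⊤ := by
      rw [hE₂, Measure.volume_eq_prod, Measure.prod_prod]
      exact ENNReal.mul_lt_top (by simp) (by simp)
    refine Measure.integrableOn_of_bounded (M := 5 * N) hfin.ne mGf.aestronglyMeasurable
      ((ae_restrict_iff' (m2 R)).2 (Eventually.of_forall fun y hy => ?_))
    rw [norm_mul]
    have h1 : (1 : ℝ) ≤ y.1 := hy.1.1.le
    refine mul_le_mul ((hG5 y h1 hy.2.1).trans ?_) (hN y) (abs_nonneg _) (by norm_num)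
    exact div_le_self (by norm_num) (one_le_pow₀ h1)
  set B : ℝ → ℝ := fun R => ∫ z in Icc 0 R, G11 x (R, z) * primitive f (R, z) with hB
  have Bbound : ∀ R, 1 ≤ R → ‖B R‖ ≤ 5 * N / R := by
    intro R hR
    have := norm_setIntegral_le_of_norm_le_const (μ := volume) (s := Icc 0 R) (C := 5 / R ^ 2 * N)
      (f := fun z => G11 x (R, z) * primitive f (R, z)) (by simp) (fun z hz => by
        rw [norm_mul]
        exact mul_le_mul (hG5 (R, z) hR hz.1) (hF _) (abs_nonneg _) (by positivity))
    refine this.trans (le_of_eq ?_)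
    rw [Real.volume_real_Icc_of_le (by linarith)]
    field_simp
    ring
  have tB : Tendsto B atTop (𝓝 0) := by
    refine squeeze_zero_norm' ((eventually_ge_atTop 1).mono Bbound) ?_
    exact tendsto_const_nhds.div_atTop tendsto_id
  have parts : ∀ R, 1 ≤ R → ∫ y in box R \ box 1, G11 x y * f y
      = (∫ y in E₁ R, G11 x y * f y) + (B R - ∫ y in E₂ R, G11deriv x y * primitive f y) := by
    intro R hR
    have hset : box R \ box 1 = E₁ R ∪ E₂ R := by
      ext y
      simp only [Set.mem_sdiff, mem_box, hE₁, hE₂, mem_union, mem_prod, mem_Icc, mem_Ioc]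
      constructor
      · rintro ⟨⟨⟨a1, a2⟩, a3, a4⟩, hn⟩
        rcases le_or_gt y.1 1 with h | h
        · left
          refine ⟨⟨a1, h⟩, ?_, a4⟩
          by_contra hc
          exact hn ⟨⟨a1, h⟩, a3, not_lt.1 hc⟩
        · exact Or.inr ⟨⟨h, a2⟩, a3, a4⟩
      · rintro (⟨⟨a1, a2⟩, a3, a4⟩ | ⟨⟨a1, a2⟩, a3, a4⟩)
        · exact ⟨⟨⟨a1, a2.trans hR⟩, by linarith, a4⟩, fun h => by linarith [h.2.2]⟩
        · exact ⟨⟨⟨by linarith, a2⟩, a3, a4⟩, fun h => by linarith [h.1.2]⟩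
    have hdisj : Disjoint (E₁ R) (E₂ R) := Set.disjoint_left.2 fun y h1 h2 =>
      absurd h1.1.2 (not_le.2 h2.1.1)
    rw [hset, setIntegral_union hdisj (m2 R) (i1 R) (i3 R)]
    congr 1
    have swap : ∀ J : Plane → ℝ, IntegrableOn J (E₂ R) →
        IntegrableOn (fun z => ∫ s in (1 : ℝ)..R, J (s, z)) (Icc 0 R) ∧
        ∫ y in E₂ R, J y = ∫ z in Icc 0 R, ∫ s in (1 : ℝ)..R, J (s, z) := by
      intro J hJ
      rw [IntegrableOn, hE₂, Measure.volume_eq_prod, ← Measure.prod_restrict] at hJ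
      simp only [intervalIntegral.integral_of_le hR]
      refine ⟨hJ.integral_prod_right, ?_⟩
      rw [hE₂, Measure.volume_eq_prod, ← Measure.prod_restrict, integral_prod_symm _ hJ]
    obtain ⟨-, eG⟩ := swap _ (i3 R)
    obtain ⟨iD, eD⟩ := swap _ (i2 R)
    have hBi : IntegrableOn (fun z => G11 x (R, z) * primitive f (R, z)) (Icc 0 R) := by
      have hm : Measurable fun z : ℝ => G11 x (R, z) * primitive f (R, z) :=
        ((measurable_G11 x).mul hFc.measurable).comp measurable_prodMk_left
      refine Measure.integrableOn_of_bounded (M := 5 / R ^ 2 * N) (by simp) hm.aestronglyMeasurable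
        ((ae_restrict_iff' measurableSet_Icc).2 (Eventually.of_forall fun z hz => ?_))
      rw [norm_mul]
      exact mul_le_mul (hG5 (R, z) hR hz.1) (hF _) (abs_nonneg _) (by positivity)
    rw [eG, eD, hB, ← integral_sub hBi iD]
    refine setIntegral_congr_fun measurableSet_Icc fun z hz => ?_
    have hcu : ∀ s ∈ uIcc 1 R, HasDerivAt (fun s => G11 x (s, z)) (G11deriv x (s, z)) s :=
      fun s hs => by
        rw [uIcc_of_le hR] at hs
        exact hasDerivAt_G11 (y := (s, z)) hx1 hx1' hx2 hs.1 hz.1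
    have hcg : Continuous fun s : ℝ => f (s, z) := by fun_prop
    have hcv : ∀ s ∈ uIcc 1 R, HasDerivAt (fun s => primitive f (s, z)) (f (s, z)) s :=
      fun s _ => intervalIntegral.integral_hasDerivAt_right (hcg.intervalIntegrable _ _)
        (hcg.stronglyMeasurableAtFilter _ _) hcg.continuousAt
    have hiu : IntervalIntegrable (fun s => G11deriv x (s, z)) volume 1 R := by
      rw [intervalIntegrable_iff_integrableOn_Ioc_of_le hR]
      refine Measure.integrableOn_of_bounded (M := 16) (by simp)
        ((measurable_G11deriv x).comp measurable_prodMk_right).aestronglyMeasurable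
        ((ae_restrict_iff' measurableSet_Ioc).2 (Eventually.of_forall fun s hs => ?_))
      have hn := n2 (s, z) hs.1.le
      exact (abs_G11deriv_far hx1 hx1' hx2 (by linarith [hs.1]) hz.1 hn).trans
        (div_le_self (by norm_num) (one_le_pow₀ hn))
    have := intervalIntegral.integral_mul_deriv_eq_deriv_mul hcu hcv hiu
      (hcg.intervalIntegrable _ _)
    have e0 : primitive f (1, z) = 0 := intervalIntegral.integral_same
    simp only [this, e0, mul_zero, sub_zero]
  refine ⟨l1 + (0 - l2), ?_, ?_⟩
  · refine (t1.add (tB.sub t2)).congr' ?_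
    filter_upwards [eventually_ge_atTop 1] with R hR
    exact (parts R hR).symm
  · rw [zero_sub]
    refine (abs_add_le _ _).trans ?_
    rw [abs_neg]
    linarith

/-! ### The lower bound at a fixed time -/

lemma c0_pos : 0 < c0 := div_pos two_pos Real.pi_pos

lemma far_K1 {x : Plane} (hx1 : 0 ≤ x.1) (hx1' : x.1 ≤ 1 / 4) (hx2 : |x.2| ≤ 1 / 4)
    {f : Plane → ℝ} (hf : ContDiff ℝ 1 f) (hp : IsPeriodic f) (ho : IsDoubleOdd f) {N : ℝ}
    (hN : ∀ y, |f y| ≤ N) :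
    ∃ l, Tendsto (farPart K1 f x) atTop (𝓝 (c0 * l)) ∧ |l| ≤ 512 * N * ∫ y, japanese y := by
  obtain ⟨l, tl, bl⟩ := far_G11 hx1 hx1' hx2 hf.continuous hp ho hN
  obtain ⟨l', tl', bl'⟩ := far_G11 (x := bar x) hx1 hx1' (by simpa [bar] using hx2)
    hf.continuous hp ho hN
  refine ⟨l + l', ?_, (abs_add_le _ _).trans (by linarith)⟩
  refine ((tl.add tl').const_mul c0).congr fun R => ?_
  obtain ⟨L, hL⟩ := exists_linear_bound hf ho.zero_left R
  have h1 := (integrableOn_G11_mul hx1 hf.continuous hL).mono_set (sdiff_subset (t := box 1))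
  have h2 := (integrableOn_G11_mul (x := bar x) hx1 hf.continuous hL).mono_set
    (sdiff_subset (t := box 1))
  simp only [farPart, K1, G12_eq, add_mul, integral_add h1 h2]

lemma snd_le_len (x : Plane) : x.2 ≤ len x :=
  Real.le_sqrt_of_sq_le (by unfold lenSq; nlinarith [sq_nonneg x.1])

lemma fst_le_len (x : Plane) : x.1 ≤ len x :=
  Real.le_sqrt_of_sq_le (by unfold lenSq; nlinarith [sq_nonneg x.2])

/-- The hypotheses on the vorticity at a fixed time; `n` measures how small the set is where the
vorticity differs from its maximum `N`. -/
structure IsNearlyMaximal (f : Plane → ℝ) (N : ℝ) (n : ℕ) : Prop where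
  contDiff : ContDiff ℝ 1 f
  periodic : IsPeriodic f
  odd : IsDoubleOdd f
  mem_Icc : ∀ y ∈ box 1, f y ∈ Icc 0 N
  abs_le : ∀ y, |f y| ≤ N
  defect : volume.real (box 1 \ {y | f y = N}) ≤ ((1 / 2) ^ n) ^ 2 / 8

lemma Q1_lower {f : Plane → ℝ} {N : ℝ} {n : ℕ} (h : IsNearlyMaximal f N n)
    (hn : Real.pi + 512 * (∫ y, japanese y) + 1 ≤ n / 480) {α : ℝ} (hα0 : 0 < α) (hα1 : α < 1)
    {x : Plane} (hx1 : 0 ≤ x.1) (hx2 : 0 ≤ x.2) (hxn : len x ≤ (1 / 2) ^ n)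
    (hx : len x ≤ 1 / 4) :
    QopExists K1 f x ∧
      c0 * N ≤ Q1 f x + c0 * Real.pi / (1 - α) ^ 2 * M α f x * len x ^ (1 - α) := by
  have hN : 0 ≤ N := (abs_nonneg _).trans (h.abs_le 0)
  have hz := h.odd.zero_left
  have l1 := fst_le_len x
  have l2 := snd_le_len x
  obtain ⟨l, tl, bl⟩ := far_K1 hx1 (l1.trans hx) (by rw [abs_of_nonneg hx2]; exact l2.trans hx)
    h.contDiff h.periodic h.odd h.abs_le
  refine ⟨⟨integrableOn_K1_mul hx1 h.contDiff hz, _, tl⟩, ?_⟩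
  have hM := M_nonneg α f x
  have h1α : 0 < 1 - α := by linarith
  have near := near_lower hx1 hx2 h.contDiff hz hα0 hα1 hN (div_nonneg hM h1α.le)
    (fun y hy => (h.mem_Icc y hy).1) (fun y hy => (h.mem_Icc y hy).2)
    (fun y hy => le_M_mul_rpow h.contDiff hz hα0 hα1 hy)
  have main := main_lower hx1 hx2 h.contDiff hz hN (fun y hy => (h.mem_Icc y hy).1)
    (l1.trans hxn) (l2.trans hxn) h.defect
  have hpow : x.2 ^ (1 - α) ≤ len x ^ (1 - α) := Real.rpow_le_rpow hx2 l2 h1α.le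
  -- One factor `1/(1-α)` comes from integrating the gradient bound, the other from the singularity
  -- `|y₂ - x₂|^(-α)`.
  have hMl : Real.pi * (M α f x / (1 - α) * (x.2 ^ (1 - α) / (1 - α)))
      ≤ Real.pi / (1 - α) ^ 2 * M α f x * len x ^ (1 - α) := by
    calc _ = Real.pi / (1 - α) ^ 2 * M α f x * x.2 ^ (1 - α) := by field_simp
      _ ≤ _ := by
        have := Real.pi_pos
        gcongr
  have hnN := mul_le_mul_of_nonneg_right hn hN
  have hl := neg_le_of_abs_le bl
  -- The choice of `n` makes the dyadic gain exceed the near loss `πN` and the far loss by at least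
  -- `N`.
  have total : N ≤ (∫ y in box 1, K1 x y * f y) + l
      + Real.pi / (1 - α) ^ 2 * M α f x * len x ^ (1 - α) := by linarith
  have hQ : Q1 f x = c0 * ((∫ y in box 1, K1 x y * f y) + l) := by
    rw [Q1, Qop, tl.limUnder_eq, mul_add]
  rw [hQ]
  calc c0 * N ≤ _ := mul_le_mul_of_nonneg_left total c0_pos.le
    _ = _ := by ring

/-! ### Exchanging the two variables -/

lemma measurePreserving_swap : MeasurePreserving (Prod.swap : Plane → Plane) := by
  rw [Measure.volume_eq_prod]; exact Measure.measurePreserving_swap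

lemma measurableEmbedding_swap : MeasurableEmbedding (Prod.swap : Plane → Plane) :=
  MeasurableEquiv.prodComm.measurableEmbedding

lemma swap_preimage_box (r : ℝ) : Prod.swap ⁻¹' box r = box r := by
  ext y; simp only [mem_preimage, mem_box, Prod.fst_swap, Prod.snd_swap]; exact and_comm

lemma setIntegral_swap {S : Set Plane} (hS : Prod.swap ⁻¹' S = S) (J : Plane → ℝ) :
    ∫ y in S, J y.swap = ∫ y in S, J y := by
  have := measurePreserving_swap.setIntegral_preimage_emb measurableEmbedding_swap J S
  rwa [hS] at this

lemma integrableOn_swap {S : Set Plane} (hS : Prod.swap ⁻¹' S = S) {J : Plane → ℝ}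
    (hJ : IntegrableOn J S) : IntegrableOn (fun y => J y.swap) S := by
  have := (measurePreserving_swap.integrableOn_comp_preimage measurableEmbedding_swap).2 hJ
  rwa [hS] at this

lemma K2_mul_eq (f : Plane → ℝ) (x : Plane) : (fun y => K2 x y * f y)
    = fun y => (fun z => K1 x.swap z * (f ∘ Prod.swap) z) y.swap := by
  ext y; simp [K2_eq_swap]

lemma farPart_K2 (f : Plane → ℝ) (x : Plane) :
    farPart K2 f x = farPart K1 (f ∘ Prod.swap) x.swap := by
  ext R
  rw [farPart, farPart, K2_mul_eq]
  have hS : Prod.swap ⁻¹' (box R \ box 1) = box R \ box 1 := by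
    rw [preimage_sdiff, swap_preimage_box, swap_preimage_box]
  exact congrArg (c0 * ·) (setIntegral_swap hS (fun z => K1 x.swap z * (f ∘ Prod.swap) z))

lemma Q2_eq (f : Plane → ℝ) (x : Plane) : Q2 f x = Q1 (f ∘ Prod.swap) x.swap := by
  rw [Q2, Q1, Qop, Qop, farPart_K2, K2_mul_eq]
  exact congrArg (c0 * · + _)
    (setIntegral_swap (swap_preimage_box 1) (fun z => K1 x.swap z * (f ∘ Prod.swap) z))

lemma QopExists_K2 {f : Plane → ℝ} {x : Plane} (h : QopExists K1 (f ∘ Prod.swap) x.swap) :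
    QopExists K2 f x := by
  refine ⟨fun R => ?_, ?_⟩
  · rw [K2_mul_eq]
    exact integrableOn_swap (swap_preimage_box R) (h.1 R)
  · rw [farPart_K2]
    exact h.2

lemma len_swap (x : Plane) : len x.swap = len x := by
  simp [len, lenSq, add_comm]

lemma M_swap {f : Plane → ℝ} (hf : ContDiff ℝ 1 f) (α : ℝ) (x : Plane) :
    M α (f ∘ Prod.swap) x.swap = M α f x := by
  have hd : ∀ y : Plane, HasFDerivAt (f ∘ Prod.swap)
      ((fderiv ℝ f y.swap).comp
        (ContinuousLinearEquiv.prodComm ℝ ℝ ℝ : Plane →L[ℝ] Plane)) y := fun y =>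
    ((hf.differentiable one_ne_zero y.swap).hasFDerivAt).comp y
      (ContinuousLinearEquiv.prodComm ℝ ℝ ℝ : Plane →L[ℝ] Plane).hasFDerivAt
  have e1 : ∀ y, d1 (f ∘ Prod.swap) y = d2 f y.swap := fun y => by
    rw [d1, d2, (hd y).fderiv]; simp
  have e2 : ∀ y, d2 (f ∘ Prod.swap) y = d1 f y.swap := fun y => by
    rw [d1, d2, (hd y).fderiv]; simp
  unfold M
  congr 1
  have hfun : (fun y : Plane => max |y.1 ^ α * d1 (f ∘ Prod.swap) y| |y.2 ^ α * d2 (f ∘ Prod.swap) y|)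
      = (fun y : Plane => max |y.1 ^ α * d1 f y| |y.2 ^ α * d2 f y|) ∘ Prod.swap := by
    ext y; simp [e1, e2, max_comm]
  have hbox : ∀ r, Prod.swap '' box r = box r := fun r => by
    rw [image_swap_eq_preimage_swap, swap_preimage_box]
  rw [hfun, image_comp, hbox, Prod.fst_swap, Prod.snd_swap, max_comm]

lemma IsNearlyMaximal.swap {f : Plane → ℝ} {N : ℝ} {n : ℕ} (h : IsNearlyMaximal f N n) :
    IsNearlyMaximal (f ∘ Prod.swap) N n where
  contDiff := h.contDiff.comp (contDiff_snd.prodMk contDiff_fst)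
  periodic x := ⟨(h.periodic x.swap).2, (h.periodic x.swap).1⟩
  odd x := ⟨(h.odd x.swap).2, (h.odd x.swap).1⟩
  mem_Icc y hy := h.mem_Icc y.swap (by rwa [← swap_preimage_box] at hy)
  abs_le y := h.abs_le y.swap
  defect := by
    have e : box 1 \ {y | (f ∘ Prod.swap) y = N} = Prod.swap ⁻¹' (box 1 \ {y | f y = N}) := by
      rw [preimage_sdiff, swap_preimage_box]; rfl
    rw [e, measureReal_def, measurePreserving_swap.measure_preimage_emb measurableEmbedding_swap]
    exact h.defect

lemma Q2_lower {f : Plane → ℝ} {N : ℝ} {n : ℕ} (h : IsNearlyMaximal f N n)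
    (hn : Real.pi + 512 * (∫ y, japanese y) + 1 ≤ n / 480) {α : ℝ} (hα0 : 0 < α) (hα1 : α < 1)
    {x : Plane} (hx1 : 0 ≤ x.1) (hx2 : 0 ≤ x.2) (hxn : len x ≤ (1 / 2) ^ n)
    (hx : len x ≤ 1 / 4) :
    QopExists K2 f x ∧
      c0 * N ≤ Q2 f x + c0 * Real.pi / (1 - α) ^ 2 * M α f x * len x ^ (1 - α) := by
  rw [← len_swap] at hxn hx
  obtain ⟨h1, h2⟩ := Q1_lower h.swap hn hα0 hα1 (x := x.swap) hx2 hx1 hxn hx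
  rw [M_swap h.contDiff, len_swap, ← Q2_eq] at h2
  exact ⟨QopExists_K2 h1, h2⟩

/-! ### The vorticity at later times -/

lemma abs_le_of_box {f : Plane → ℝ} (hp : IsPeriodic f) (ho : IsDoubleOdd f) {N : ℝ}
    (h : ∀ y ∈ box 1, |f y| ≤ N) (y : Plane) : |f y| ≤ N := by
  have p1 : ∀ z, Function.Periodic (fun s => f (s, z)) 2 := fun z s => (hp (s, z)).1
  have p2 : ∀ s, Function.Periodic (fun z => f (s, z)) 2 := fun s z => (hp (s, z)).2
  obtain ⟨s, hs, es⟩ := (p1 y.2).exists_mem_Ico two_pos y.1 (-1)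
  obtain ⟨z, hz, ez⟩ := (p2 s).exists_mem_Ico two_pos y.2 (-1)
  have e : f y = f (s, z) := es.trans ez
  have a1 : ∀ s z, |f (|s|, z)| = |f (s, z)| := fun s z => by
    rcases abs_choice s with h | h <;> rw [h]
    rw [(ho (s, z)).1, abs_neg]
  have a2 : ∀ s z, |f (s, |z|)| = |f (s, z)| := fun s z => by
    rcases abs_choice z with h | h <;> rw [h]
    rw [(ho (s, z)).2, abs_neg]
  rw [e, ← a1, ← a2]
  refine h _ (mem_box.2 ⟨⟨abs_nonneg _, ?_⟩, abs_nonneg _, ?_⟩) <;> rw [abs_le] <;>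
    constructor <;> linarith [hs.1, hs.2, hz.1, hz.2]

lemma abs_le_supNorm {f : Plane → ℝ} (hf : Continuous f) (hp : IsPeriodic f) (ho : IsDoubleOdd f)
    (y : Plane) : |f y| ≤ supNorm f := by
  obtain ⟨C, hC⟩ := (isCompact_box 1).exists_bound_of_continuousOn hf.continuousOn
  exact le_ciSup (f := fun y => |f y|) ⟨C, by rintro _ ⟨z, rfl⟩; exact abs_le_of_box hp ho hC z⟩ y

lemma box_one_subset_closure_interior : box 1 ⊆ closure (interior (box 1)) := by
  rw [box_eq_prod, interior_prod_eq, closure_prod_eq, interior_Icc, closure_Ioo zero_ne_one]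

/-- A closed condition on the values of a continuous function which holds almost everywhere on the
unit square holds everywhere there. -/
lemma forall_mem_of_ae_box {f : Plane → ℝ} (hf : Continuous f) {F : Set ℝ} (hF : IsClosed F)
    (h : volume.restrict (box 1) (f ⁻¹' Fᶜ) = 0) : ∀ y ∈ box 1, f y ∈ F := by
  intro y hy
  by_contra hc
  have hU : IsOpen (f ⁻¹' Fᶜ) := hF.isOpen_compl.preimage hf
  have hne : (f ⁻¹' Fᶜ ∩ interior (box 1)).Nonempty :=
    mem_closure_iff.1 (box_one_subset_closure_interior hy) _ hU hc
  have hpos := (hU.inter isOpen_interior).measure_pos volume hne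
  rw [Measure.restrict_apply hU.measurableSet] at h
  exact hpos.ne' (measure_mono_null (inter_subset_inter_right _ interior_subset) h)

/-- Equality of distributions transfers the measure of the defect set directly. It transfers the
range `[0, N]` only almost everywhere, and continuity upgrades this to every point. -/
lemma isNearlyMaximal_of_euler {ω : ℝ → Plane → ℝ} (hω : IsEulerSolution ω)
    (hodd : ∀ t, 0 ≤ t → IsDoubleOdd (ω t)) (h0 : ∀ x ∈ box 1, 0 ≤ ω 0 x) {n : ℕ}
    (htop : 1 - topMeasure (ω 0) ≤ ((1 / 2) ^ n) ^ 2 / 8) {t : ℝ} (ht : 0 ≤ t) :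
    IsNearlyMaximal (ω t) (supNorm (ω 0)) n := by
  have hc : ∀ t, 0 ≤ t → Continuous (ω t) := fun t ht => (hω.contDiff t ht).continuous
  set N := supNorm (ω 0) with hN
  have hsup := abs_le_supNorm (hc 0 le_rfl) (hω.periodic 0 le_rfl) (hodd 0 le_rfl)
  have hmap : ∀ S : Set ℝ, MeasurableSet S →
      volume (ω t ⁻¹' S ∩ box 1) = volume (ω 0 ⁻¹' S ∩ box 1) := fun S hS => by
    have := congrArg (fun μ => μ S) (map_vorticity_eq hω hodd ht)
    simp only [Measure.map_apply (hc t ht).measurable hS,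
      Measure.map_apply (hc 0 le_rfl).measurable hS] at this
    rwa [Measure.restrict_apply ((hc t ht).measurable hS),
      Measure.restrict_apply ((hc 0 le_rfl).measurable hS)] at this
  have hIcc : ∀ y ∈ box 1, ω t y ∈ Icc 0 N := by
    refine forall_mem_of_ae_box (hc t ht) isClosed_Icc ?_
    rw [Measure.restrict_apply ((hc t ht).measurable measurableSet_Icc.compl),
      hmap _ measurableSet_Icc.compl]
    have : ω 0 ⁻¹' (Icc 0 N)ᶜ ∩ box 1 = ∅ := by
      ext y
      simp only [mem_inter_iff, mem_preimage, mem_compl_iff, mem_empty_iff_false, iff_false]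
      exact fun hy => hy.1 ⟨h0 y hy.2, (le_abs_self _).trans (hsup y)⟩
    rw [this, measure_empty]
  refine ⟨(hω.contDiff t ht).of_le (by norm_num), hω.periodic t ht, hodd t ht, hIcc,
    abs_le_of_box (hω.periodic t ht) (hodd t ht) fun y hy => ?_, ?_⟩
  · rw [abs_of_nonneg (hIcc y hy).1]; exact (hIcc y hy).2
  · have e : ∀ s, box 1 \ {y | ω s y = N} = ω s ⁻¹' {N}ᶜ ∩ box 1 := fun s => by
      rw [inter_comm]; rfl
    rw [e, measureReal_def, hmap _ (measurableSet_singleton N).compl, ← measureReal_def, ← e]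
    have hm : MeasurableSet {y | ω 0 y = N} :=
      measurableSet_eq_fun (hc 0 le_rfl).measurable measurable_const
    have := measureReal_inter_add_sdiff (μ := volume) (s := box 1) hm (by rw [volume_box_one]; simp)
    have hbox : volume.real (box 1) = 1 := by rw [measureReal_def, volume_box_one]; simp
    have htm : topMeasure (ω 0) = volume.real (box 1 ∩ {y | ω 0 y = N}) := rfl
    linarith

/-- If the norm were zero, `f` would attain it on the whole square and the measure would be `1`. -/
lemma supNorm_pos {f : Plane → ℝ} (hf : Continuous f) (hp : IsPeriodic f) (ho : IsDoubleOdd f)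
    (h : topMeasure f < 1) : 0 < supNorm f := by
  have hsup := abs_le_supNorm hf hp ho
  refine lt_of_le_of_ne ((abs_nonneg _).trans (hsup 0)) fun h0 => ?_
  have hz : ∀ y, f y = supNorm f := fun y => by
    rw [← h0]; exact abs_nonpos_iff.1 (h0 ▸ hsup y)
  have : {x : Plane | x ∈ box 1 ∧ f x = supNorm f} = box 1 := by
    ext y; exact ⟨fun hy => hy.1, fun hy => ⟨hy, hz y⟩⟩
  rw [topMeasure, this, measureReal_def, volume_box_one] at h
  simp at h

end EulerTorus

end


open EulerTorus
theorem mainTheorem3 :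
    ∃ m₀ K : ℝ, 0 < m₀ ∧ m₀ < 1 ∧ 0 < K ∧
      ∀ (α : ℝ) (ω : ℝ → Plane → ℝ), 0 < α → α < 1 / 4 →
        IsEulerSolution ω →
        (∀ t, 0 ≤ t → IsDoubleOdd (ω t)) →
        (∀ x ∈ box 1, 0 ≤ ω 0 x) →
        m₀ < topMeasure (ω 0) → topMeasure (ω 0) < 1 →
          (∃ β₀ A : ℝ, 0 < β₀ ∧ 0 < A ∧
            ∀ t, 0 ≤ t → ∀ x : Plane, 0 ≤ x.1 → 0 ≤ x.2 →
              len x ≤ K * (1 - topMeasure (ω 0)) →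
                QopExists K1 (ω t) x ∧ QopExists K2 (ω t) x ∧
                β₀ ≤ Q2 (ω t) x + A * M α (ω t) x * len x ^ (1 - α) ∧
                β₀ ≤ Q1 (ω t) x + A * M α (ω t) x * len x ^ (1 - α)) ∧
          HyperbolicNearOrigin α ω := by
  obtain ⟨n, hn⟩ := exists_nat_ge (480 * (Real.pi + 512 * (∫ y, japanese y) + 1))
  have hn' : Real.pi + 512 * (∫ y, japanese y) + 1 ≤ n / 480 := by
    rw [le_div_iff₀ (by norm_num)]; linarith
  -- The defect allowed by `main_lower`. As `ε ≤ 2⁻ⁿ` and `ε ≤ 1/4`, the condition `|x| ≤ 1 - m < ε`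
  -- also meets both size restrictions on `x`, so `K = 1` works.
  set ε : ℝ := ((1 / 2) ^ n) ^ 2 / 8 with hε
  have hp0 : (0 : ℝ) < (1 / 2) ^ n := by positivity
  have hp1 : (1 / 2 : ℝ) ^ n ≤ 1 := pow_le_one₀ (by norm_num) (by norm_num)
  have hε0 : 0 < ε := by positivity
  have hε1 : ε ≤ (1 / 2) ^ n := by rw [hε]; nlinarith
  have hε2 : ε ≤ 1 / 4 := by rw [hε]; nlinarith
  refine ⟨1 - ε, 1, by linarith, by linarith, one_pos, ?_⟩
  intro α ω hα0 hα4 hω hodd h0 hm hm1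
  have hα1 : α < 1 := by linarith
  have h1α : 0 < 1 - α := by linarith
  have hc := c0_pos
  have hN := supNorm_pos (hω.contDiff 0 le_rfl).continuous (hω.periodic 0 le_rfl) (hodd 0 le_rfl)
    hm1
  have hA : 0 < c0 * Real.pi / (1 - α) ^ 2 := by have := Real.pi_pos; positivity
  have main : ∀ t, 0 ≤ t → ∀ x : Plane, 0 ≤ x.1 → 0 ≤ x.2 →
      len x ≤ 1 * (1 - topMeasure (ω 0)) →
        QopExists K1 (ω t) x ∧ QopExists K2 (ω t) x ∧
        c0 * supNorm (ω 0) ≤ Q2 (ω t) x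
          + c0 * Real.pi / (1 - α) ^ 2 * M α (ω t) x * len x ^ (1 - α) ∧
        c0 * supNorm (ω 0) ≤ Q1 (ω t) x
          + c0 * Real.pi / (1 - α) ^ 2 * M α (ω t) x * len x ^ (1 - α) := by
    intro t ht x hx1 hx2 hx
    have h := isNearlyMaximal_of_euler hω hodd h0 (n := n) (by linarith) ht
    obtain ⟨a1, a2⟩ := Q1_lower h hn' hα0 hα1 hx1 hx2 (by linarith) (by linarith)
    obtain ⟨b1, b2⟩ := Q2_lower h hn' hα0 hα1 hx1 hx2 (by linarith) (by linarith)
    exact ⟨a1, b1, b2, a2⟩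
  -- Half of `1 - m` suffices as `ρ`, since the square of side `ρ` has diagonal `√2 ρ ≤ 1 - m`.
  refine ⟨⟨_, _, mul_pos hc hN, hA, main⟩, (1 - topMeasure (ω 0)) / 2, _, _, by linarith, hA,
    mul_pos hc hN, ?_⟩
  intro t ht x hx1 hx1' hx2 hx2'
  have hlen : len x ≤ 1 * (1 - topMeasure (ω 0)) := by
    refine Real.sqrt_le_iff.2 ⟨by linarith, ?_⟩
    unfold lenSq
    nlinarith
  obtain ⟨-, -, q2, q1⟩ := main t ht x hx1 hx2 hlen
  rw [mul_right_comm] at q1 q2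
  exact ⟨q1, q2⟩
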